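/- **Theorem.** Let $M$ be a smooth four-dimensional manifold with a smooth Lorentzian metric $g$ of signature $(-,+,+,+)$, let $U\subseteq M$ be open, and let $\{e_\alpha\}_{\alpha=0,\dots,3}$ be a smooth $g$-orthonormal frame on $U$ with dual coframe $\{\vartheta^\alpha\}$. Frame indices are raised and lowered with $g_{\alpha\beta}=\mathrm{diag}(-1,1,1,1)$ and summed when repeated. Let $\nabla^W$ be the Weitzenböck connection of the frame on $U$, $\nabla^W_{e_\alpha}e_\beta=0$, with connection $1$-forms $\omega_\alpha{}^\beta$ given by $\nabla^W e_\alpha=\omega_\alpha{}^\beta e_\beta$ and torsion $2$-forms $T^\alpha(X,Y)=\vartheta^\alpha(\nabla^W_XY-\nabla^W_YX-[X,Y])$. Let $\widetilde\nabla$ be the Levi-Civita connection of $g$ on $U$, with $\widetilde R(X,Y)Z=\widetilde\nabla_X\widetilde\nabla_YZ-\widetilde\nabla_Y\widetilde\nabla_XZ-\widetilde\nabla_{[X,Y]}Z$, $\widetilde R_{\alpha\beta}=\vartheta^\gamma(\widetilde R(e_\gamma,e_\beta)e_\alpha)$, and $\widetilde R=g^{\alpha\beta}\widetilde R_{\alpha\beta}$.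 Put $\eta=\vartheta^0\wedge\vartheta^1\wedge\vartheta^2\wedge\vartheta^3$, $\eta_\alpha=e_\alpha\rfloor\eta$, $\eta^\alpha=g^{\alpha\beta}\eta_\beta$, and let $\star$ be the Hodge dual, $\star(\vartheta_{\alpha_1}\wedge\cdots\wedge\vartheta_{\alpha_k})=e_{\alpha_k}\rfloor\cdots e_{\alpha_1}\rfloor\eta$. Decompose the torsion as $T^\alpha={}^{(1)}T^\alpha+{}^{(2)}T^\alpha+{}^{(3)}T^\alpha$ with $${}^{(2)}T^\alpha=\tfrac13\vartheta^\alpha\wedge(e_\beta\rfloor T^\beta),\qquad {}^{(3)}T^\alpha=\tfrac13\star\big(\star(\vartheta_\beta\wedge T^\beta)\wedge\vartheta^\alpha\big).$$ For real $\kappa\neq0$ let $$L=-\frac1{2\kappa}\,T^\alpha\wedge\star\Big(-{}^{(1)}T_\alpha+2\,{}^{(2)}T_\alpha+\tfrac12\,{}^{(3)}T_\alpha\Big),\qquad H_\alpha=\frac1\kappa\star\Big(-{}^{(1)}T_\alpha+2\,{}^{(2)}T_\alpha+\tfrac12\,{}^{(3)}T_\alpha\Big),$$ and $DH_\alpha=dH_\alpha-\omega_\alpha{}^\beta\wedge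 H_\beta$. Then: 1. $H_\alpha=-\partial L/\partial T^\alpha$, that is, for all $2$-forms $\tau^\alpha$ at a point of $U$, $\frac{d}{ds}\big|_{s=0}L(T+s\tau)=-\tau^\alpha\wedge H_\alpha$. 2. On $U$, identically, $$DH_\alpha-e_\alpha\rfloor L-(e_\alpha\rfloor T^\beta)\wedge H_\beta=-\frac1\kappa\Big(\widetilde R_{\alpha\beta}-\tfrac12\widetilde R\,g_{\alpha\beta}\Big)\eta^\beta .$$ 3. Consequently, for every family of matter $3$-forms $\mathcal T_\alpha=\mathcal T_{\alpha\beta}\,\eta^\beta$ on $U$, the translational field equation $$DH_\alpha-e_\alpha\rfloor L-(e_\alpha\rfloor T^\beta)\wedge H_\beta=\mathcal T_\alpha\qquad(\alpha=0,\dots,3)$$ holds on $U$ if and only if Einstein's equation $\widetilde R_{\alpha\beta}-\frac12\widetilde R\,g_{\alpha\beta}=-\kappa\,\mathcal T_{\alpha\beta}$ holds on $U$. If the overall sign of the gravitational Lagrangian, hence of $L$ and $H_\alpha$, is reversed (that is, $\kappa$ is replaced by $-\kappa$ in both), the field equation holds on $U$ if and only if $\widetilde R_{\alpha\beta}-\frac12\widetilde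 R\,g_{\alpha\beta}=\kappa\,\mathcal T_{\alpha\beta}$ holds on $U$. -/

import Mathlib

open scoped Manifold ContDiff

noncomputable section

namespace TEGR

/-! ### Exterior algebra of a four-dimensional Minkowski vector space

`V` is a real vector space with an orthonormal frame `e` and its dual coframe `ϑ`
(signature `(-,+,+,+)`, orientation `ϑ⁰ ∧ ϑ¹ ∧ ϑ² ∧ ϑ³`). -/

section Pointwise

variable {V : Type*} [AddCommGroup V] [Module ℝ V]

/-- The diagonal entries `-1, 1, 1, 1` of the Minkowski metric; they raise and lower indices. -/
def sgn : Fin 4 → ℝ := ![-1, 1, 1, 1]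

/-- The Minkowski metric `diag (-1, 1, 1, 1)`. -/
def minkowski (α β : Fin 4) : ℝ := if α = β then sgn α else 0

/-- Alternating `k`-forms on `V`. -/
abbrev Form (V : Type*) [AddCommGroup V] [Module ℝ V] (k : ℕ) := V [⋀^Fin k]→ₗ[ℝ] ℝ

/-- A linear functional as a `1`-form. -/
def oneForm (f : V →ₗ[ℝ] ℝ) : Form V 1 := AlternatingMap.ofSubsingleton ℝ V ℝ (0 : Fin 1) f

/-- The exterior product (sum over shuffles, so that
`(a ∧ b) (u, v) = a u * b v - a v * b u` for `1`-forms). -/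
def wedge {k l : ℕ} (a : Form V k) (b : Form V l) : Form V (k + l) :=
  ((LinearMap.mul' ℝ ℝ).compAlternatingMap (a.domCoprod b)).domDomCongr finSumFinEquiv

/-- The interior product `v ⌋ a`, inserting `v` in the first slot. -/
def contract {k : ℕ} (v : V) (a : Form V (k + 1)) : Form V k := a.curryLeft v

/-- The volume form `η = ϑ⁰ ∧ ϑ¹ ∧ ϑ² ∧ ϑ³`, that is `η (v₀, …, v₃) = det (ϑⁱ (vⱼ))`. -/
def volumeForm (ϑ : Fin 4 → V →ₗ[ℝ] ℝ) : Form V 4 :=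
  (Matrix.detRowAlternating : (Fin 4 → ℝ) [⋀^Fin 4]→ₗ[ℝ] ℝ).compLinearMap (LinearMap.pi ϑ)

/-- The `3`-form `η_α = e_α ⌋ η`. -/
def eta1 (e : Fin 4 → V) (ϑ : Fin 4 → V →ₗ[ℝ] ℝ) (α : Fin 4) : Form V 3 :=
  contract (e α) (volumeForm ϑ)

/-- The `2`-form `η_{αβ} = e_β ⌋ η_α`. -/
def eta2 (e : Fin 4 → V) (ϑ : Fin 4 → V →ₗ[ℝ] ℝ) (α β : Fin 4) : Form V 2 :=
  contract (e β) (eta1 e ϑ α)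

/-- The `1`-form `η_{αβγ} = e_γ ⌋ η_{αβ}`. -/
def eta3 (e : Fin 4 → V) (ϑ : Fin 4 → V →ₗ[ℝ] ℝ) (α β γ : Fin 4) : Form V 1 :=
  contract (e γ) (eta2 e ϑ α β)

/-- The `3`-form with raised index, `η^α`. -/
def eta1Up (e : Fin 4 → V) (ϑ : Fin 4 → V →ₗ[ℝ] ℝ) (α : Fin 4) : Form V 3 :=
  sgn α • eta1 e ϑ α

/-- The Hodge dual of a `2`-form, `⋆φ = (1/2!) φ^{αβ} η_{αβ}`. -/
def hodge2 (e : Fin 4 → V) (ϑ : Fin 4 → V →ₗ[ℝ] ℝ) (φ : Form V 2) : Form V 2 :=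
  (1 / 2 : ℝ) • ∑ α, ∑ β, (sgn α * sgn β * φ ![e α, e β]) • eta2 e ϑ α β

/-- The Hodge dual of a `3`-form, `⋆φ = (1/3!) φ^{αβγ} η_{αβγ}`. -/
def hodge3 (e : Fin 4 → V) (ϑ : Fin 4 → V →ₗ[ℝ] ℝ) (φ : Form V 3) : Form V 1 :=
  (1 / 6 : ℝ) • ∑ α, ∑ β, ∑ γ,
    (sgn α * sgn β * sgn γ * φ ![e α, e β, e γ]) • eta3 e ϑ α β γ

/-- The vector part `⁽²⁾T^α = (1/3) ϑ^α ∧ (e_β ⌋ T^β)` of a family of `2`-forms `T^α`. -/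
def vectorPart (e : Fin 4 → V) (ϑ : Fin 4 → V →ₗ[ℝ] ℝ) (T : Fin 4 → Form V 2) (α : Fin 4) :
    Form V 2 :=
  (1 / 3 : ℝ) • wedge (oneForm (ϑ α)) (∑ β, contract (e β) (T β))

/-- The axial part `⁽³⁾T^α = (1/3) ⋆(⋆(ϑ_β ∧ T^β) ∧ ϑ^α)`. -/
def axialPart (e : Fin 4 → V) (ϑ : Fin 4 → V →ₗ[ℝ] ℝ) (T : Fin 4 → Form V 2) (α : Fin 4) :
    Form V 2 :=
  (1 / 3 : ℝ) • hodge2 e ϑ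
    (wedge (hodge3 e ϑ (∑ β, sgn β • wedge (oneForm (ϑ β)) (T β))) (oneForm (ϑ α)))

/-- The tensor part `⁽¹⁾T^α = T^α - ⁽²⁾T^α - ⁽³⁾T^α`. -/
def tensorPart (e : Fin 4 → V) (ϑ : Fin 4 → V →ₗ[ℝ] ℝ) (T : Fin 4 → Form V 2) (α : Fin 4) :
    Form V 2 :=
  T α - vectorPart e ϑ T α - axialPart e ϑ T α

/-- The dual form `⋆(-⁽¹⁾T_α + 2 ⁽²⁾T_α + (1/2) ⁽³⁾T_α)`, with lower index `α`. -/
def dualCombination (e : Fin 4 → V) (ϑ : Fin 4 → V →ₗ[ℝ] ℝ) (T : Fin 4 → Form V 2) (α : Fin 4) :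
    Form V 2 :=
  hodge2 e ϑ (sgn α • (-tensorPart e ϑ T α + (2 : ℝ) • vectorPart e ϑ T α
    + (1 / 2 : ℝ) • axialPart e ϑ T α))

/-- The gravitational Lagrangian `4`-form
`L = -(1/2κ) T^α ∧ ⋆(-⁽¹⁾T_α + 2 ⁽²⁾T_α + (1/2) ⁽³⁾T_α)`. -/
def lagrangian (κ : ℝ) (e : Fin 4 → V) (ϑ : Fin 4 → V →ₗ[ℝ] ℝ) (T : Fin 4 → Form V 2) :
    Form V 4 :=
  (-(1 / (2 * κ))) • ∑ α, wedge (T α) (dualCombination e ϑ T α)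

/-- The translational excitation `H_α = (1/κ) ⋆(-⁽¹⁾T_α + 2 ⁽²⁾T_α + (1/2) ⁽³⁾T_α)`. -/
def excitation (κ : ℝ) (e : Fin 4 → V) (ϑ : Fin 4 → V →ₗ[ℝ] ℝ) (T : Fin 4 → Form V 2)
    (α : Fin 4) : Form V 2 :=
  (1 / κ) • dualCombination e ϑ T α

end Pointwise

/-! ### Spacetime -/

/-- The model space of a four-dimensional manifold. -/
abbrev E4 := EuclideanSpace ℝ (Fin 4)

/-- A smooth Lorentzian metric of signature `(-,+,+,+)` on a four-dimensional manifold. -/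
structure LorentzMetric (M : Type*) [TopologicalSpace M] [ChartedSpace E4 M]
    [IsManifold (𝓡 4) ∞ M] where
  inner : ∀ x : M, TangentSpace (𝓡 4) x →L[ℝ] TangentSpace (𝓡 4) x →L[ℝ] ℝ
  symm : ∀ (x : M) (v w : TangentSpace (𝓡 4) x), inner x v w = inner x w v
  signature : ∀ x : M, ∃ b : Module.Basis (Fin 4) ℝ (TangentSpace (𝓡 4) x),
    ∀ α β, inner x (b α) (b β) = minkowski α β
  contMDiff : ContMDiff (𝓡 4) ((𝓡 4).prod 𝓘(ℝ, E4 →L[ℝ] E4 →L[ℝ] ℝ)) ∞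
    (fun x : M => Bundle.TotalSpace.mk' (E4 →L[ℝ] E4 →L[ℝ] ℝ)
      (E := fun y : M => TangentSpace (𝓡 4) y →L[ℝ] TangentSpace (𝓡 4) y →L[ℝ] ℝ) x (inner x))

section Manifold

variable {M : Type*} [TopologicalSpace M] [ChartedSpace E4 M]

/-- Vector fields on `M` (no regularity). -/
abbrev VField (M : Type*) [TopologicalSpace M] [ChartedSpace E4 M] :=
  ∀ x : M, TangentSpace (𝓡 4) x

/-- The data of an affine connection; `cov Y x v` is `(∇_v Y) (x)`. -/
abbrev Conn (M : Type*) [TopologicalSpace M] [ChartedSpace E4 M] :=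
  VField M → ∀ x : M, TangentSpace (𝓡 4) x →L[ℝ] TangentSpace (𝓡 4) x

/-- The torsion `T(X, Y) = ∇_X Y - ∇_Y X - [X, Y]`. -/
def torsion (cov : Conn M) (X Y : VField M) : VField M := fun x =>
  cov Y x (X x) - cov X x (Y x) - VectorField.mlieBracket (𝓡 4) X Y x

/-- The curvature `R(X, Y) Z = ∇_X ∇_Y Z - ∇_Y ∇_X Z - ∇_{[X, Y]} Z`. -/
def curvature (cov : Conn M) (X Y Z : VField M) : VField M := fun x =>
  cov (fun y => cov Z y (Y y)) x (X x) - cov (fun y => cov Z y (X y)) x (Y x)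
    - cov Z x (VectorField.mlieBracket (𝓡 4) X Y x)

/-- The exterior derivative of a `2`-form `φ`, evaluated on three vector fields:
`dφ(X,Y,Z) = X φ(Y,Z) - Y φ(X,Z) + Z φ(X,Y) - φ([X,Y],Z) + φ([X,Z],Y) - φ([Y,Z],X)`. -/
def extDeriv2 (φ : ∀ x : M, Form (TangentSpace (𝓡 4) x) 2) (X : Fin 3 → VField M) (x : M) : ℝ :=
  mvfderiv (𝓡 4) (fun y => φ y ![X 1 y, X 2 y]) x (X 0 x)
    - mvfderiv (𝓡 4) (fun y => φ y ![X 0 y, X 2 y]) x (X 1 x)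
    + mvfderiv (𝓡 4) (fun y => φ y ![X 0 y, X 1 y]) x (X 2 x)
    - φ x ![VectorField.mlieBracket (𝓡 4) (X 0) (X 1) x, X 2 x]
    + φ x ![VectorField.mlieBracket (𝓡 4) (X 0) (X 2) x, X 1 x]
    - φ x ![VectorField.mlieBracket (𝓡 4) (X 1) (X 2) x, X 0 x]

variable [IsManifold (𝓡 4) ∞ M]

/-- The vector field `X` is smooth on `U`. -/
def SmoothOn (X : VField M) (U : Set M) : Prop :=
  ContMDiffOn (𝓡 4) (𝓡 4).tangent ∞ (fun x => (⟨x, X x⟩ : TangentBundle (𝓡 4) M)) U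

/-- The vector field `X` is differentiable at `x`. -/
def DiffAt (X : VField M) (x : M) : Prop :=
  MDifferentiableAt (𝓡 4) (𝓡 4).tangent (fun y => (⟨y, X y⟩ : TangentBundle (𝓡 4) M)) x

/-- `e` is a smooth orthonormal frame (tetrad) on `U`. -/
structure IsTetradOn (g : LorentzMetric M) (e : Fin 4 → VField M) (U : Set M) : Prop where
  smooth : ∀ α, SmoothOn (e α) U
  orthonormal : ∀ x ∈ U, ∀ α β, g.inner x (e α x) (e β x) = minkowski α β

/-- The coframe dual to a tetrad, `ϑ^α = g^{αα} g(e_α, ·)`. -/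
def coframe (g : LorentzMetric M) (e : Fin 4 → VField M) (x : M) (α : Fin 4) :
    TangentSpace (𝓡 4) x →ₗ[ℝ] ℝ :=
  sgn α • (g.inner x (e α x)).toLinearMap

theorem coframe_apply_frame {g : LorentzMetric M} {e : Fin 4 → VField M} {U : Set M}
    (he : IsTetradOn g e U) {x : M} (hx : x ∈ U) (α β : Fin 4) :
    coframe g e x α (e β x) = if α = β then 1 else 0 := by
  have h := he.orthonormal x hx α β
  simp only [coframe, LinearMap.smul_apply, ContinuousLinearMap.coe_coe, h, minkowski, smul_eq_mul]
  split_ifs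
  · fin_cases α <;> simp [sgn]
  · simp

/-- `cov` is an affine connection on `U` for which the frame `e` is parallel. -/
structure IsWeitzenbockOn (cov : Conn M) (e : Fin 4 → VField M) (U : Set M) : Prop where
  isCovariantDerivativeOn : IsCovariantDerivativeOn E4 cov U
  parallel : ∀ x ∈ U, ∀ α β, cov (e β) x (e α x) = 0

/-- `cov` is the Levi-Civita connection of `g` on `U`. -/
structure IsLeviCivitaOn (g : LorentzMetric M) (cov : Conn M) (U : Set M) : Prop where
  isCovariantDerivativeOn : IsCovariantDerivativeOn E4 cov U
  torsion_free : ∀ x ∈ U, ∀ X Y : VField M, DiffAt X x → DiffAt Y x → torsion cov X Y x = 0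
  metric : ∀ x ∈ U, ∀ X Y : VField M, DiffAt X x → DiffAt Y x → ∀ v : TangentSpace (𝓡 4) x,
    mvfderiv (𝓡 4) (fun y => g.inner y (X y) (Y y)) x v =
      g.inner x (cov X x v) (Y x) + g.inner x (X x) (cov Y x v)

/-- The torsion `2`-forms `T^α = (1/2) T_{μν}^α ϑ^μ ∧ ϑ^ν`, with `T(e_μ, e_ν) = T_{μν}^α e_α`. -/
def torsionForm (g : LorentzMetric M) (e : Fin 4 → VField M) (cov : Conn M) (x : M) (α : Fin 4) :
    Form (TangentSpace (𝓡 4) x) 2 :=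
  (1 / 2 : ℝ) • ∑ μ, ∑ ν, (coframe g e x α (torsion cov (e μ) (e ν) x)) •
    wedge (oneForm (coframe g e x μ)) (oneForm (coframe g e x ν))

/-- The connection `1`-forms `ω_α^β`, with `∇ e_α = ω_α^β e_β`. -/
def connectionForm (g : LorentzMetric M) (e : Fin 4 → VField M) (cov : Conn M) (x : M)
    (α β : Fin 4) : Form (TangentSpace (𝓡 4) x) 1 :=
  oneForm ((coframe g e x β).comp (cov (e α) x).toLinearMap)

/-- The Lagrangian `4`-form of the torsion of `cov` in the tetrad `e`. -/
def lagrangianForm (κ : ℝ) (g : LorentzMetric M) (e : Fin 4 → VField M) (cov : Conn M) (x : M) :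
    Form (TangentSpace (𝓡 4) x) 4 :=
  lagrangian κ (fun α => e α x) (coframe g e x) (torsionForm g e cov x)

/-- The excitation `2`-forms `H_α` of the torsion of `cov` in the tetrad `e`. -/
def excitationForm (κ : ℝ) (g : LorentzMetric M) (e : Fin 4 → VField M) (cov : Conn M)
    (x : M) (α : Fin 4) : Form (TangentSpace (𝓡 4) x) 2 :=
  excitation κ (fun β => e β x) (coframe g e x) (torsionForm g e cov x) α

/-- The covariant exterior derivative `D H_α = d H_α - ω_α^β ∧ H_β` of a family of `2`-forms,
evaluated on three vector fields. -/
def covExtDeriv2 (g : LorentzMetric M) (e : Fin 4 → VField M) (cov : Conn M)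
    (H : ∀ x : M, Fin 4 → Form (TangentSpace (𝓡 4) x) 2) (α : Fin 4) (X : Fin 3 → VField M)
    (x : M) : ℝ :=
  extDeriv2 (fun y => H y α) X x
    - ∑ β, wedge (connectionForm g e cov x α β) (H x β) (fun i => X i x)

/-- The left-hand side `D H_α - e_α ⌋ L - (e_α ⌋ T^β) ∧ H_β` of the translational field equation,
evaluated on three vector fields. -/
def fieldOperator (κ : ℝ) (g : LorentzMetric M) (e : Fin 4 → VField M) (cov : Conn M)
    (α : Fin 4) (X : Fin 3 → VField M) (x : M) : ℝ :=
  covExtDeriv2 g e cov (excitationForm κ g e cov) α X x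
    - contract (e α x) (lagrangianForm κ g e cov x) (fun i => X i x)
    - ∑ β, wedge (contract (e α x) (torsionForm g e cov x β)) (excitationForm κ g e cov x β)
        (fun i => X i x)

/-- The translational field equation `D H_α - e_α ⌋ L - (e_α ⌋ T^β) ∧ H_β = 𝒯_α` on `U`, as an
equation between `3`-forms tested on smooth vector fields. -/
def TranslationalFieldEquation (κ : ℝ) (g : LorentzMetric M) (e : Fin 4 → VField M)
    (cov : Conn M) (U : Set M) (𝒯 : Fin 4 → ∀ x : M, Form (TangentSpace (𝓡 4) x) 3) : Prop :=
  ∀ (α : Fin 4) (X : Fin 3 → VField M), (∀ i, SmoothOn (X i) U) → ∀ x ∈ U,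
    fieldOperator κ g e cov α X x = 𝒯 α x (fun i => X i x)

/-- The tetrad components `R_{αβ} = Ric_α (e_β) = ϑ^γ (R(e_γ, e_β) e_α)` of the Ricci tensor. -/
def ricci (g : LorentzMetric M) (e : Fin 4 → VField M) (cov : Conn M) (α β : Fin 4) (x : M) : ℝ :=
  ∑ γ, coframe g e x γ (curvature cov (e γ) (e β) (e α) x)

/-- The scalar curvature `R = g^{αβ} R_{αβ}`. -/
def scalarCurvature (g : LorentzMetric M) (e : Fin 4 → VField M) (cov : Conn M) (x : M) : ℝ :=
  ∑ α, sgn α * ricci g e cov α α x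

/-- The tetrad components `R_{αβ} - (1/2) R g_{αβ}` of the Einstein tensor. -/
def einstein (g : LorentzMetric M) (e : Fin 4 → VField M) (cov : Conn M) (α β : Fin 4) (x : M) :
    ℝ :=
  ricci g e cov α β x - (1 / 2) * scalarCurvature g e cov x * minkowski α β

/-- Einstein's equation `R_{αβ} - (1/2) R g_{αβ} = κ t_{αβ}` on `U`, in tetrad components. -/
def EinsteinEquation (κ : ℝ) (g : LorentzMetric M) (e : Fin 4 → VField M) (cov : Conn M)
    (U : Set M) (t : Fin 4 → Fin 4 → M → ℝ) : Prop :=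
  ∀ x ∈ U, ∀ α β, einstein g e cov α β x = κ * t α β x

end Manifold

end TEGR

end

/-!
The identity behind the theorem is algebraic once everything is written in the tetrad, where the
Weitzenböck connection forms vanish and its torsion consists of the structure functions,
`T^k (e_i, e_j) = -ϑ^k ([e_i, e_j])`.

*Reduction to components.* Since `-⁽¹⁾T + 2 ⁽²⁾T + (1/2) ⁽³⁾T = -T + 3 ⁽²⁾T + (3/2) ⁽³⁾T`, the
excitation is the Hodge dual of an explicit linear expression in the torsion, the superpotential
(`dualCombination_frame`). Evaluating wedge products on frame vectors (`wedge_one_two_apply`,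
`wedge_two_two_apply`) turns the left-hand side of the field equation into a polynomial
`fieldComponents` in the torsion components and, linearly, their frame derivatives. The exterior
derivative is defined on vector fields by brackets; it is shown to be tensorial and to equal
`ϑ^m ∧ ∇_m φ + (e_k ⌋ φ) ∧ T^k` for the connection that makes the frame parallel
(`extDeriv2_eq_frameExtDeriv`), so it too can be evaluated on frame vectors.

*Comparison with the Levi-Civita connection.* Let `G i j k = ϑ^k (∇_{e_i} e_j)`. Metric
compatibility makes `G i j k` antisymmetric in `j, k` after lowering `k`, vanishing torsion gives
`T^k (e_i, e_j) = G j i k - G i j k`, and Koszul's formula shows that `G` is differentiable. In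
terms of `G` the superpotential is a single coefficient up to traces (`superpotential_torsionOf`),
and the field equation becomes the Einstein tensor by expansion (`fieldComponents_torsionOf`). The
Einstein tensor arises there with its two indices interchanged; the Jacobi identity for the frame
vector fields, which is the first Bianchi identity, makes the Ricci tensor symmetric
(`ricciOf_comm`, `einstein_eq_einsteinOf`).

*Momentum.* The Lagrangian is a quadratic form in the torsion whose polar form
`T^α ∧ ⋆(-⁽¹⁾S_α + 2 ⁽²⁾S_α + (1/2) ⁽³⁾S_α)` is symmetric
(`wedgePairing_dualSuperpotential_comm`), so its derivative in the direction `τ` is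
`-τ^α ∧ H_α` (`hasDerivAt_lagrangian`).

*Equivalence with Einstein's equation.* The `3`-forms `η^β` are linearly independent
(`eta1Up_coefficients_ext`), and the frame fields themselves are admissible test fields.
-/

noncomputable section

namespace TEGR

/-! ### Wedge products evaluated on vectors -/

/-- Signed sums over permutations, split according to the image of `0`. -/
theorem sum_perm_succ {n : ℕ} (f : (Fin (n + 1) → Fin (n + 1)) → ℝ) :
    ∑ σ : Equiv.Perm (Fin (n + 1)), ((Equiv.Perm.sign σ : ℤ) : ℝ) * f σ =
      ∑ p : Fin (n + 1), (if p = 0 then 1 else -1) * ∑ τ : Equiv.Perm (Fin n),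
        ((Equiv.Perm.sign τ : ℤ) : ℝ) * f (Fin.cons p fun i => Equiv.swap 0 p (τ i).succ) := by
  rw [← Equiv.Perm.decomposeFin.symm.sum_comp, Fintype.sum_prod_type]
  refine Finset.sum_congr rfl fun p _ => ?_
  rw [Finset.mul_sum]
  refine Finset.sum_congr rfl fun τ _ => ?_
  have : (Equiv.Perm.decomposeFin.symm (p, τ) : Fin (n + 1) → Fin (n + 1)) =
      Fin.cons p fun i => Equiv.swap 0 p (τ i).succ := by
    ext i
    refine Fin.cases ?_ (fun j => ?_) i <;> simp
  rw [this, Equiv.Perm.decomposeFin.symm_sign]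
  split_ifs <;> simp

theorem sum_perm_two (f : (Fin 2 → Fin 2) → ℝ) :
    ∑ σ : Equiv.Perm (Fin 2), ((Equiv.Perm.sign σ : ℤ) : ℝ) * f σ = f ![0,1] - f ![1,0] := by
  rw [sum_perm_succ]
  have h (p : Fin 2) (τ : Equiv.Perm (Fin 1)) :
      (Fin.cons p fun i => Equiv.swap 0 p (τ i).succ) =
        (![p, Equiv.swap 0 p 1] : Fin 2 → Fin 2) := by
    ext i; fin_cases i <;> simp [Subsingleton.elim τ 1]
  simp [h, Fin.sum_univ_two]
  ring

theorem sum_perm_three (f : (Fin 3 → Fin 3) → ℝ) :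
    ∑ σ : Equiv.Perm (Fin 3), ((Equiv.Perm.sign σ : ℤ) : ℝ) * f σ = f ![0,1,2] - f ![0,2,1]
      - f ![1,0,2] + f ![1,2,0] + f ![2,0,1] - f ![2,1,0] := by
  rw [sum_perm_succ]
  have h (p : Fin 3) := sum_perm_two (fun g => f (Fin.cons p fun i => Equiv.swap 0 p (g i).succ))
  have h' (p : Fin 3) (g : Fin 2 → Fin 2) :
      (Fin.cons p fun i => Equiv.swap 0 p (g i).succ) =
        (![p, Equiv.swap 0 p (g 0).succ, Equiv.swap 0 p (g 1).succ] : Fin 3 → Fin 3) := by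
    funext i; fin_cases i <;> rfl
  simp only [h]
  simp only [h']
  simp [Fin.sum_univ_three, Equiv.swap_apply_def]
  ring

theorem sum_perm_four (f : (Fin 4 → Fin 4) → ℝ) :
    ∑ σ : Equiv.Perm (Fin 4), ((Equiv.Perm.sign σ : ℤ) : ℝ) * f σ =
    ((f ![0,1,2,3] - f ![0,1,3,2]) - (f ![0,2,1,3] - f ![0,2,3,1]) + (f ![0,3,1,2] - f ![0,3,2,1]))
    - ((f ![1,0,2,3] - f ![1,0,3,2]) - (f ![1,2,0,3] - f ![1,2,3,0])
      + (f ![1,3,0,2] - f ![1,3,2,0]))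
    + ((f ![2,0,1,3] - f ![2,0,3,1]) - (f ![2,1,0,3] - f ![2,1,3,0])
      + (f ![2,3,0,1] - f ![2,3,1,0]))
    - ((f ![3,0,1,2] - f ![3,0,2,1]) - (f ![3,1,0,2] - f ![3,1,2,0])
      + (f ![3,2,0,1] - f ![3,2,1,0])) := by
  rw [sum_perm_succ]
  have h (p : Fin 4) := sum_perm_three (fun g => f (Fin.cons p fun i => Equiv.swap 0 p (g i).succ))
  have h' (p : Fin 4) (g : Fin 3 → Fin 3) :
      (Fin.cons p fun i => Equiv.swap 0 p (g i).succ) =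
        (![p, Equiv.swap 0 p (g 0).succ, Equiv.swap 0 p (g 1).succ,
          Equiv.swap 0 p (g 2).succ] : Fin 4 → Fin 4) := by
    funext i; fin_cases i <;> rfl
  simp only [h]
  simp only [h']
  simp [Fin.sum_univ_four, Equiv.swap_apply_def]
  ring

section Wedge

variable {V : Type*} [AddCommGroup V] [Module ℝ V]

/-- The wedge product as a normalised sum over all permutations of the arguments. -/
theorem wedge_apply_eq_sum_perm {k l : ℕ} (a : Form V k) (b : Form V l) (v : Fin (k + l) → V) :
    (k.factorial * l.factorial : ℝ) * wedge a b v =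
      ∑ σ : Equiv.Perm (Fin (k + l)), ((Equiv.Perm.sign σ : ℤ) : ℝ) *
        (a (fun i => v (σ (Fin.castAdd l i))) * b (fun j => v (σ (Fin.natAdd k j)))) := by
  have h := congrArg (fun f => (LinearMap.mul' ℝ ℝ) (f (v ∘ finSumFinEquiv)))
    (MultilinearMap.domCoprod_alternization_eq a b)
  simp only [Fintype.card_fin, MultilinearMap.alternatization_apply, AlternatingMap.smul_apply,
    map_sum, MultilinearMap.domDomCongr_apply, MultilinearMap.domCoprod_apply,
    map_nsmul] at h
  have h2 : wedge a b v = (LinearMap.mul' ℝ ℝ) ((a.domCoprod b) (v ∘ finSumFinEquiv)) := rfl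
  rw [h2]
  rw [nsmul_eq_mul] at h
  push_cast at h
  -- The shuffle sum, times `k! l!`, is the sum over all permutations of the slots.
  rw [← h]
  refine Fintype.sum_equiv (Equiv.permCongr finSumFinEquiv) _ _ fun σ => ?_
  simp only [Equiv.Perm.sign_permCongr]
  rcases Int.units_eq_one_or (Equiv.Perm.sign σ) with hs | hs <;>
    simp [hs, Equiv.permCongr_apply]

theorem form_two_swap (a : Form V 2) (u v : V) : a ![v, u] = -a ![u, v] := by
  have h := a.map_swap ![u, v] (i := 0) (j := 1) (by decide)
  rw [← h]
  congr 1
  ext i; fin_cases i <;> rfl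

theorem form_two_self (a : Form V 2) (u : V) : a ![u, u] = 0 :=
  a.map_eq_zero_of_eq _ (i := 0) (j := 1) rfl (by decide)

theorem wedge_one_one_apply (a b : Form V 1) (v : Fin 2 → V) :
    wedge a b v = a ![v 0] * b ![v 1] - a ![v 1] * b ![v 0] := by
  have h := wedge_apply_eq_sum_perm a b v
  rw [sum_perm_two (fun σ : Fin 2 → Fin 2 =>
    a (fun i => v (σ (Fin.castAdd 1 i))) * b (fun j => v (σ (Fin.natAdd 1 j))))] at h
  have e1 : ∀ (f : Fin 1 → V), f = ![f 0] := fun f => by ext i; fin_cases i; rfl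
  rw [e1 fun _ => v (![0, 1] _), e1 fun _ => v (![1, 0] _), e1 fun _ => v (![0, 1] _),
    e1 fun _ => v (![1, 0] _)] at h
  simpa using h

theorem wedge_one_two_apply (a : Form V 1) (b : Form V 2) (v : Fin 3 → V) :
    wedge a b v = a ![v 0] * b ![v 1, v 2] - a ![v 1] * b ![v 0, v 2]
      + a ![v 2] * b ![v 0, v 1] := by
  have h := wedge_apply_eq_sum_perm a b v
  rw [sum_perm_three (fun σ : Fin 3 → Fin 3 =>
    a (fun i => v (σ (Fin.castAdd 2 i))) * b (fun j => v (σ (Fin.natAdd 1 j))))] at h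
  have e1 : ∀ p q r : Fin 3, (fun i : Fin 1 => v ((![p, q, r] : Fin 3 → Fin 3) (Fin.castAdd 2 i)))
    = ![v p] := fun p q r => by funext i; fin_cases i; rfl
  have e2 : ∀ p q r : Fin 3, (fun i : Fin 2 => v ((![p, q, r] : Fin 3 → Fin 3) (Fin.natAdd 1 i)))
    = ![v q, v r] := fun p q r => by funext i; fin_cases i <;> rfl
  simp only [e1, e2, form_two_swap b (v 0) (v 1), form_two_swap b (v 0) (v 2),
    form_two_swap b (v 1) (v 2)] at h
  norm_num [Nat.factorial] at h
  linarith

theorem wedge_two_two_apply (a b : Form V 2) (v : Fin 4 → V) :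
    wedge a b v = a ![v 0, v 1] * b ![v 2, v 3] - a ![v 0, v 2] * b ![v 1, v 3]
      + a ![v 0, v 3] * b ![v 1, v 2] + a ![v 1, v 2] * b ![v 0, v 3]
      - a ![v 1, v 3] * b ![v 0, v 2] + a ![v 2, v 3] * b ![v 0, v 1] := by
  have h := wedge_apply_eq_sum_perm a b v
  rw [sum_perm_four (fun σ : Fin 4 → Fin 4 =>
    a (fun i => v (σ (Fin.castAdd 2 i))) * b (fun j => v (σ (Fin.natAdd 2 j))))] at h
  have e1 : ∀ p q r s : Fin 4, (fun i : Fin 2 => v ((![p, q, r, s] : Fin 4 → Fin 4)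
    (Fin.castAdd 2 i))) = ![v p, v q] := fun p q r s => by funext i; fin_cases i <;> rfl
  have e2 : ∀ p q r s : Fin 4, (fun i : Fin 2 => v ((![p, q, r, s] : Fin 4 → Fin 4)
    (Fin.natAdd 2 i))) = ![v r, v s] := fun p q r s => by funext i; fin_cases i <;> rfl
  simp only [e1, e2, form_two_swap _ (v 0) (v 1), form_two_swap _ (v 0) (v 2),
    form_two_swap _ (v 0) (v 3), form_two_swap _ (v 1) (v 2), form_two_swap _ (v 1) (v 3),
    form_two_swap _ (v 2) (v 3)] at h
  norm_num [Nat.factorial] at h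
  linarith

end Wedge

/-! ### Components with respect to a frame -/

/-- The Levi-Civita symbol on `{0, 1, 2, 3}`, as a normalised Vandermonde product. The
division in `ℤ` is exact: the product is `0` or `±12`. -/
def leviCivita (a b c d : Fin 4) : ℤ :=
  ((b : ℤ) - a) * ((c : ℤ) - a) * ((d : ℤ) - a) * ((c : ℤ) - b) * ((d : ℤ) - b) * ((d : ℤ) - c) / 12

theorem det_eq_leviCivita : ∀ a b c d : Fin 4,
    (Matrix.of fun i j => if j = (![a, b, c, d] : Fin 4 → Fin 4) i then (1 : ℤ) else 0).det =
      leviCivita a b c d := by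
  decide +kernel

theorem leviCivita_one_two_three : ∀ α, leviCivita α 1 2 3 = if α = 0 then 1 else 0 := by decide

theorem leviCivita_zero_two_three : ∀ α, leviCivita α 0 2 3 = if α = 1 then -1 else 0 := by decide

theorem leviCivita_zero_one_three : ∀ α, leviCivita α 0 1 3 = if α = 2 then 1 else 0 := by decide

theorem leviCivita_zero_one_two : ∀ α, leviCivita α 0 1 2 = if α = 3 then -1 else 0 := by decide

/-- The components of `⋆(-⁽¹⁾T_α + 2 ⁽²⁾T_α + (1/2) ⁽³⁾T_α)` before dualisation, in terms of the
torsion components `t α i j = T^α (e_i, e_j)`: the three summands are those of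
`-T + (3/2) ⁽³⁾T + 3 ⁽²⁾T`. -/
def superpotential (t : Fin 4 → Fin 4 → Fin 4 → ℝ) (α i j : Fin 4) : ℝ :=
  -(sgn α * t α i j) + 1 / 2 * (sgn α * t α i j + sgn i * t i j α + sgn j * t j α i)
    + (minkowski α i * ∑ β, t β β j - minkowski α j * ∑ β, t β β i)

/-- The components `(1/2) φ^{ab} η_{abij}` of the Hodge dual of a `2`-form with components `φ`. -/
def dualComponents (φ : Fin 4 → Fin 4 → ℝ) (i j : Fin 4) : ℝ :=
  1 / 2 * ∑ a, ∑ b, sgn a * sgn b * φ a b * leviCivita a b i j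

@[simp] theorem sgn_zero : sgn 0 = -1 := rfl
@[simp] theorem sgn_one : sgn 1 = 1 := rfl
@[simp] theorem sgn_two : sgn 2 = 1 := rfl
@[simp] theorem sgn_three : sgn 3 = 1 := rfl

theorem dualComponents_swap (φ : Fin 4 → Fin 4 → ℝ) (i j : Fin 4) :
    dualComponents φ j i = -dualComponents φ i j := by
  have h : ∀ a b c d, leviCivita a b d c = -leviCivita a b c d := by decide +kernel
  simp [dualComponents, h _ _ i j]

theorem dualComponents_zero_one (φ : Fin 4 → Fin 4 → ℝ) :
    dualComponents φ 0 1 = 1 / 2 * (φ 2 3 - φ 3 2) := by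
  simp [dualComponents, leviCivita, Fin.sum_univ_four]; ring

theorem dualComponents_zero_two (φ : Fin 4 → Fin 4 → ℝ) :
    dualComponents φ 0 2 = 1 / 2 * (φ 3 1 - φ 1 3) := by
  simp [dualComponents, leviCivita, Fin.sum_univ_four]; ring

theorem dualComponents_zero_three (φ : Fin 4 → Fin 4 → ℝ) :
    dualComponents φ 0 3 = 1 / 2 * (φ 1 2 - φ 2 1) := by
  simp [dualComponents, leviCivita, Fin.sum_univ_four]; ring

theorem dualComponents_one_two (φ : Fin 4 → Fin 4 → ℝ) :
    dualComponents φ 1 2 = 1 / 2 * (φ 3 0 - φ 0 3) := by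
  simp [dualComponents, leviCivita, Fin.sum_univ_four]; ring

theorem dualComponents_one_three (φ : Fin 4 → Fin 4 → ℝ) :
    dualComponents φ 1 3 = 1 / 2 * (φ 0 2 - φ 2 0) := by
  simp [dualComponents, leviCivita, Fin.sum_univ_four]; ring

theorem dualComponents_two_three (φ : Fin 4 → Fin 4 → ℝ) :
    dualComponents φ 2 3 = 1 / 2 * (φ 1 0 - φ 0 1) := by
  simp [dualComponents, leviCivita, Fin.sum_univ_four]; ring

/-- Expands the axial part of the torsion: with `A = ⋆(ϑ_β ∧ T^β)`, the components of
`⋆(A ∧ ϑ^α)` are the cyclic sums of the torsion components. -/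
theorem axial_components (t : Fin 4 → Fin 4 → Fin 4 → ℝ) (ht : ∀ k i j, t k j i = -t k i j)
    (A : Fin 4 → ℝ)
    (hA : ∀ i, A i = 1 / 6 * ∑ a, ∑ b, ∑ c, sgn a * sgn b * sgn c *
      (sgn a * t a b c - sgn b * t b a c + sgn c * t c a b) * leviCivita a b c i)
    (α i j : Fin 4) :
    dualComponents (fun a b => A a * (if α = b then 1 else 0) - A b * (if α = a then 1 else 0)) i j
      = sgn α * (sgn α * t α i j + sgn i * t i j α + sgn j * t j α i) := by
  have ht0 : ∀ k i, t k i i = 0 := fun k i => by linarith [ht k i i]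
  have hA0 : A 0 = -(t 1 2 3 - t 2 1 3 + t 3 1 2) := by
    rw [hA]
    norm_num [Fin.sum_univ_four, leviCivita, ht _ 0 1, ht _ 0 2, ht _ 0 3, ht _ 1 2,
      ht _ 1 3, ht _ 2 3]
    ring
  have hA1 : A 1 = -(-t 0 2 3 - t 2 0 3 + t 3 0 2) := by
    rw [hA]
    norm_num [Fin.sum_univ_four, leviCivita, ht _ 0 1, ht _ 0 2, ht _ 0 3, ht _ 1 2,
      ht _ 1 3, ht _ 2 3]
    ring
  have hA2 : A 2 = (-t 0 1 3 - t 1 0 3 + t 3 0 1) := by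
    rw [hA]
    norm_num [Fin.sum_univ_four, leviCivita, ht _ 0 1, ht _ 0 2, ht _ 0 3, ht _ 1 2,
      ht _ 1 3, ht _ 2 3]
    ring
  have hA3 : A 3 = -(-t 0 1 2 - t 1 0 2 + t 2 0 1) := by
    rw [hA]
    norm_num [Fin.sum_univ_four, leviCivita, ht _ 0 1, ht _ 0 2, ht _ 0 3, ht _ 1 2,
      ht _ 1 3, ht _ 2 3]
    ring
  clear hA
  have key : ∀ i j, i < j → dualComponents (fun a b => A a * (if α = b then 1 else 0)
        - A b * (if α = a then 1 else 0)) i j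
      = sgn α * (sgn α * t α i j + sgn i * t i j α + sgn j * t j α i) := by
    intro i j hij
    fin_cases i <;> fin_cases j <;> (try exact absurd hij (by decide)) <;>
      simp only [Fin.zero_eta, Fin.mk_one, Fin.reduceFinMk, dualComponents_zero_one,
        dualComponents_zero_two, dualComponents_zero_three, dualComponents_one_two,
        dualComponents_one_three, dualComponents_two_three, hA0, hA1, hA2, hA3] <;>
      fin_cases α <;>
      simp [ht _ 0 1, ht _ 0 2, ht _ 0 3, ht _ 1 2,
      ht _ 1 3, ht _ 2 3, ht0] <;>
      ring
  rcases lt_trichotomy i j with h | rfl | h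
  · exact key i j h
  · have h := dualComponents_swap (fun a b => A a * (if α = b then 1 else 0)
        - A b * (if α = a then 1 else 0)) i i
    rw [ht i i α, ht0]
    linarith
  · rw [dualComponents_swap, key j i h, ht α i j, ht i j α, ht j i α]; ring

section Frame

variable {V : Type*} [AddCommGroup V] [Module ℝ V]

theorem form_sum_apply {k : ℕ} {ι : Type*} (s : Finset ι) (f : ι → Form V k) (v : Fin k → V) :
    (∑ i ∈ s, f i) v = ∑ i ∈ s, f i v :=
  map_sum (⟨⟨fun g => g v, rfl⟩, fun _ _ => rfl⟩ : Form V k →+ ℝ) f s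

theorem volumeForm_frame {e : Fin 4 → V} {ϑ : Fin 4 → V →ₗ[ℝ] ℝ}
    (hd : ∀ α β, ϑ α (e β) = if α = β then 1 else 0) (a b c d : Fin 4) :
    volumeForm ϑ ![e a, e b, e c, e d] = leviCivita a b c d := by
  rw [← det_eq_leviCivita, Int.cast_det]
  refine congrArg (Matrix.det (n := Fin 4) (R := ℝ)) ?_
  ext i j
  have h : (![e a, e b, e c, e d] : Fin 4 → V) i = e (![a, b, c, d] i) := by
    fin_cases i <;> rfl
  change ϑ j ((![e a, e b, e c, e d] : Fin 4 → V) i) =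
    (((if j = ![a, b, c, d] i then (1 : ℤ) else 0) : ℤ) : ℝ)
  rw [h, hd]
  push_cast
  rfl

theorem hodge2_frame {e : Fin 4 → V} {ϑ : Fin 4 → V →ₗ[ℝ] ℝ}
    (hd : ∀ α β, ϑ α (e β) = if α = β then 1 else 0) (φ : Form V 2) (i j : Fin 4) :
    hodge2 e ϑ φ ![e i, e j] = dualComponents (fun a b => φ ![e a, e b]) i j := by
  have h : ∀ a b, eta2 e ϑ a b ![e i, e j] = leviCivita a b i j := fun a b =>
    volumeForm_frame hd a b i j
  simp [hodge2, dualComponents, form_sum_apply, h]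

theorem hodge3_frame {e : Fin 4 → V} {ϑ : Fin 4 → V →ₗ[ℝ] ℝ}
    (hd : ∀ α β, ϑ α (e β) = if α = β then 1 else 0) (φ : Form V 3) (i : Fin 4) :
    hodge3 e ϑ φ ![e i] = 1 / 6 * ∑ a, ∑ b, ∑ c,
      sgn a * sgn b * sgn c * φ ![e a, e b, e c] * leviCivita a b c i := by
  have h : ∀ a b c, eta3 e ϑ a b c ![e i] = leviCivita a b c i := fun a b c =>
    volumeForm_frame hd a b c i
  simp [hodge3, form_sum_apply, h]

theorem oneForm_apply (f : V →ₗ[ℝ] ℝ) (v : V) : oneForm f ![v] = f v := rfl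

theorem vectorPart_frame {e : Fin 4 → V} {ϑ : Fin 4 → V →ₗ[ℝ] ℝ}
    (hd : ∀ α β, ϑ α (e β) = if α = β then 1 else 0) (T : Fin 4 → Form V 2) (α i j : Fin 4) :
    vectorPart e ϑ T α ![e i, e j] =
      1 / 3 * ((if α = i then 1 else 0) * ∑ β, T β ![e β, e j]
        - (if α = j then 1 else 0) * ∑ β, T β ![e β, e i]) := by
  have h : ∀ k, (∑ β, contract (e β) (T β)) ![e k] = ∑ β, T β ![e β, e k] := fun k => by
    rw [form_sum_apply]; rfl
  have h2 := wedge_one_one_apply (oneForm (ϑ α)) (∑ β, contract (e β) (T β)) ![e i, e j]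
  simp only [Matrix.cons_val_zero, Matrix.cons_val_one, oneForm_apply, hd, h] at h2
  rw [← h2]
  rfl

theorem axialPart_frame {e : Fin 4 → V} {ϑ : Fin 4 → V →ₗ[ℝ] ℝ}
    (hd : ∀ α β, ϑ α (e β) = if α = β then 1 else 0) (T : Fin 4 → Form V 2) (α i j : Fin 4) :
    axialPart e ϑ T α ![e i, e j] =
      1 / 3 * sgn α * (sgn α * T α ![e i, e j] + sgn i * T i ![e j, e α]
        + sgn j * T j ![e α, e i]) := by
  have hw : ∀ a b c : Fin 4, (∑ β, sgn β • wedge (oneForm (ϑ β)) (T β)) ![e a, e b, e c] =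
      sgn a * T a ![e b, e c] - sgn b * T b ![e a, e c] + sgn c * T c ![e a, e b] := by
    intro a b c
    have h2 : ∀ β, wedge (oneForm (ϑ β)) (T β) ![e a, e b, e c] =
      (if β = a then 1 else 0) * T β ![e b, e c] - (if β = b then 1 else 0) * T β ![e a, e c]
        + (if β = c then 1 else 0) * T β ![e a, e b] := by
      intro β
      rw [← hd β a, ← hd β b, ← hd β c]
      exact wedge_one_two_apply _ _ ![e a, e b, e c]
    rw [form_sum_apply]
    simp only [AlternatingMap.smul_apply, smul_eq_mul]
    refine (Finset.sum_congr rfl fun β _ => congrArg (sgn β * ·) (h2 β)).trans ?_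
    simp [mul_add, mul_sub, Finset.sum_add_distrib, Finset.sum_sub_distrib]
  set A := hodge3 e ϑ (∑ β, sgn β • wedge (oneForm (ϑ β)) (T β)) with hA
  have hsw : ∀ k a b, T k ![e b, e a] = -T k ![e a, e b] := fun k a b => form_two_swap _ _ _
  have hs0 : ∀ k a, T k ![e a, e a] = 0 := fun k a => form_two_self _ _
  have hww : ∀ a b, wedge A (oneForm (ϑ α)) ![e a, e b] =
      A ![e a] * (if α = b then 1 else 0) - A ![e b] * (if α = a then 1 else 0) := by
    intro a b
    rw [← hd α b, ← hd α a]
    exact wedge_one_one_apply A (oneForm (ϑ α)) ![e a, e b]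
  have hmain : axialPart e ϑ T α ![e i, e j] = 1 / 3 *
      dualComponents (fun a b => A ![e a] * (if α = b then 1 else 0)
        - A ![e b] * (if α = a then 1 else 0)) i j := by
    simp only [← hww]
    rw [← hodge2_frame hd]
    rfl
  have hAi : ∀ i, A ![e i] = _ := fun i => hodge3_frame hd _ i
  simp only [hw] at hAi
  rw [hmain, axial_components (fun k a b => T k ![e a, e b]) hsw (fun i => A ![e i]) hAi]
  ring

end Frame

/-! ### The component identity -/

/-- The torsion components `T^k (e_i, e_j)` of the Weitzenböck connection in terms of the
Levi-Civita coefficients `G i j k = ϑ^k (∇_{e_i} e_j)`. -/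
def torsionOf (G : Fin 4 → Fin 4 → Fin 4 → ℝ) (k i j : Fin 4) : ℝ := G j i k - G i j k

/-- The components of the Ricci tensor in terms of the connection coefficients
`G i j k = ϑ^k (∇_{e_i} e_j)` and their frame derivatives `DG m i j k = e_m (G i j k)`. -/
def ricciOf (G : Fin 4 → Fin 4 → Fin 4 → ℝ) (DG : Fin 4 → Fin 4 → Fin 4 → Fin 4 → ℝ)
    (α β : Fin 4) : ℝ :=
  ∑ γ, (DG γ β α γ - DG β γ α γ
    + ∑ l, (G β α l * G γ l γ - G γ α l * G β l γ + torsionOf G l γ β * G l α γ))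

/-- The components of the Einstein tensor. -/
def einsteinOf (G : Fin 4 → Fin 4 → Fin 4 → ℝ) (DG : Fin 4 → Fin 4 → Fin 4 → Fin 4 → ℝ)
    (α β : Fin 4) : ℝ :=
  ricciOf G DG α β - 1 / 2 * (∑ γ, sgn γ * ricciOf G DG γ γ) * minkowski α β

theorem sgn_ne_zero (i : Fin 4) : sgn i ≠ 0 := by
  fin_cases i <;> norm_num [sgn]

theorem metric_coefficient_self {G : Fin 4 → Fin 4 → Fin 4 → ℝ}
    (hG : ∀ i j k, sgn k * G i j k = -(sgn j * G i k j)) (i j : Fin 4) : G i j j = 0 := by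
  have h := hG i j j
  exact (mul_eq_zero.1 (by linarith : sgn j * G i j j = 0)).resolve_left (sgn_ne_zero j)

/-- In Levi-Civita coefficients the superpotential is a single coefficient up to traces. -/
theorem superpotential_torsionOf (G : Fin 4 → Fin 4 → Fin 4 → ℝ)
    (hG : ∀ i j k, sgn k * G i j k = -(sgn j * G i k j)) (α i j : Fin 4) :
    superpotential (torsionOf G) α i j = sgn i * G α j i
      - (minkowski α i * ∑ β, G β j β - minkowski α j * ∑ β, G β i β) := by
  have h0 := metric_coefficient_self hG
  simp only [superpotential, torsionOf, Finset.sum_sub_distrib, h0, Finset.sum_const_zero]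
  linear_combination (-1 / 2) * hG j i α + (1 / 2) * hG i j α - (1 / 2) * hG α i j

/-- The value on `(e_0, e_1, e_2, e_3)` of `∑ T^α ∧ φ_α` for families of `2`-forms with
components `t` and `h`. -/
def wedgePairing (t h : Fin 4 → Fin 4 → Fin 4 → ℝ) : ℝ :=
  ∑ α, (t α 0 1 * h α 2 3 - t α 0 2 * h α 1 3 + t α 0 3 * h α 1 2 + t α 1 2 * h α 0 3
      - t α 1 3 * h α 0 2 + t α 2 3 * h α 0 1)

/-- The dual components of the superpotential. -/
def dualSuperpotential (t : Fin 4 → Fin 4 → Fin 4 → ℝ) (α : Fin 4) : Fin 4 → Fin 4 → ℝ :=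
  dualComponents (superpotential t α)

/-- The components of `D H_α - e_α ⌋ L - (e_α ⌋ T^β) ∧ H_β` for unit coupling, in terms of the
torsion components and their frame derivatives. -/
def fieldComponents (t : Fin 4 → Fin 4 → Fin 4 → ℝ) (Dt : Fin 4 → Fin 4 → Fin 4 → Fin 4 → ℝ)
    (α i j k : Fin 4) : ℝ :=
  (dualSuperpotential (Dt i) α j k - dualSuperpotential (Dt j) α i k
    + dualSuperpotential (Dt k) α i j)
  + ∑ m, (dualSuperpotential t α m i * t m j k - dualSuperpotential t α m j * t m i k
    + dualSuperpotential t α m k * t m i j)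
  + 1 / 2 * wedgePairing t (dualSuperpotential t) * leviCivita α i j k
  - ∑ β, (t β α i * dualSuperpotential t β j k - t β α j * dualSuperpotential t β i k
    + t β α k * dualSuperpotential t β i j)

set_option maxHeartbeats 2000000 in
/-- The gravitational field equation in components. No Jacobi identity enters: with the free index
in the second slot, the Einstein tensor arises from the field strength alone. -/
theorem fieldComponents_torsionOf (G : Fin 4 → Fin 4 → Fin 4 → ℝ)
    (DG : Fin 4 → Fin 4 → Fin 4 → Fin 4 → ℝ)
    (hG : ∀ i j k, sgn k * G i j k = -(sgn j * G i k j))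
    (hDG : ∀ m i j k, sgn k * DG m i j k = -(sgn j * DG m i k j)) (α : Fin 4) {i j k : Fin 4}
    (hij : i < j) (hjk : j < k) :
    fieldComponents (torsionOf G) (fun m => torsionOf (DG m)) α i j k =
      -∑ β, einsteinOf G DG β α * (sgn β * leviCivita β i j k) := by
  have ds : ∀ φ i j, dualComponents φ j i = -dualComponents φ i j := dualComponents_swap
  have d0 : ∀ φ i, dualComponents φ i i = 0 := fun φ i => by linarith [ds φ i i]
  have h0 : ∀ i j, G i j j = 0 := metric_coefficient_self hG
  have h1 : ∀ m i j, DG m i j j = 0 := fun m => metric_coefficient_self (hDG m)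
  have a01 : ∀ i, G i 1 0 = G i 0 1 := fun i => by simpa using hG i 1 0
  have a02 : ∀ i, G i 2 0 = G i 0 2 := fun i => by simpa using hG i 2 0
  have a03 : ∀ i, G i 3 0 = G i 0 3 := fun i => by simpa using hG i 3 0
  have a12 : ∀ i, G i 2 1 = -G i 1 2 := fun i => by simpa using hG i 2 1
  have a13 : ∀ i, G i 3 1 = -G i 1 3 := fun i => by simpa using hG i 3 1
  have a23 : ∀ i, G i 3 2 = -G i 2 3 := fun i => by simpa using hG i 3 2
  have b01 : ∀ m i, DG m i 1 0 = DG m i 0 1 := fun m i => by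
    simpa using hDG m i 1 0
  have b02 : ∀ m i, DG m i 2 0 = DG m i 0 2 := fun m i => by
    simpa using hDG m i 2 0
  have b03 : ∀ m i, DG m i 3 0 = DG m i 0 3 := fun m i => by
    simpa using hDG m i 3 0
  have b12 : ∀ m i, DG m i 2 1 = -DG m i 1 2 := fun m i => by
    simpa using hDG m i 2 1
  have b13 : ∀ m i, DG m i 3 1 = -DG m i 1 3 := fun m i => by
    simpa using hDG m i 3 1
  have b23 : ∀ m i, DG m i 3 2 = -DG m i 2 3 := fun m i => by
    simpa using hDG m i 3 2
  have m0 : ∀ i j, i ≠ j → minkowski i j = 0 := fun i j h => if_neg h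
  have m1 : ∀ i, minkowski i i = sgn i := fun i => if_pos rfl
  have hijk : (i, j, k) = (1, 2, 3) ∨ (i, j, k) = (0, 2, 3) ∨ (i, j, k) = (0, 1, 3) ∨
      (i, j, k) = (0, 1, 2) := by
    revert i j k; decide
  -- Sixteen polynomial identities: four values of `α` for each increasing triple.
  simp only [Prod.mk.injEq] at hijk
  rcases hijk with ⟨rfl, rfl, rfl⟩ | ⟨rfl, rfl, rfl⟩ | ⟨rfl, rfl, rfl⟩ | ⟨rfl, rfl, rfl⟩ <;>
    fin_cases α <;>
    simp only [fieldComponents, dualSuperpotential, wedgePairing, einsteinOf, ricciOf,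
      Fin.zero_eta, Fin.mk_one, Fin.reduceFinMk, Fin.sum_univ_four, d0, ds _ 0 1, ds _ 0 2,
      ds _ 0 3, ds _ 1 2, ds _ 1 3, ds _ 2 3, dualComponents_zero_one, dualComponents_zero_two,
      dualComponents_zero_three, dualComponents_one_two, dualComponents_one_three,
      dualComponents_two_three, superpotential_torsionOf G hG,
      fun m => superpotential_torsionOf (DG m) (hDG m), leviCivita_one_two_three,
      leviCivita_zero_two_three, leviCivita_zero_one_three, leviCivita_zero_one_two, m1, sgn_zero,
      sgn_one, sgn_two, sgn_three] <;>
    simp only [m0, ne_eq, Fin.reduceEq, not_false_eq_true, torsionOf, h0, h1, a01, a02, a03, a12,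
      a13, a23, b01, b02, b03, b12, b13, b23, if_true, if_false] <;>
    push_cast <;> ring

set_option maxHeartbeats 2000000 in
/-- The Jacobi identity of the frame makes the Ricci tensor symmetric. -/
theorem ricciOf_comm (G : Fin 4 → Fin 4 → Fin 4 → ℝ)
    (DG : Fin 4 → Fin 4 → Fin 4 → Fin 4 → ℝ)
    (hG : ∀ i j k, sgn k * G i j k = -(sgn j * G i k j))
    (hDG : ∀ m i j k, sgn k * DG m i j k = -(sgn j * DG m i k j))
    (hJ : ∀ l i j k, torsionOf (DG k) l i j + torsionOf (DG i) l j k + torsionOf (DG j) l k i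
      + ∑ m, (torsionOf G m i j * torsionOf G l m k + torsionOf G m j k * torsionOf G l m i
        + torsionOf G m k i * torsionOf G l m j) = 0) (α β : Fin 4) :
    ricciOf G DG α β = ricciOf G DG β α := by
  have h0 : ∀ i j, G i j j = 0 := metric_coefficient_self hG
  have h1 : ∀ m i j, DG m i j j = 0 := fun m => metric_coefficient_self (hDG m)
  have a01 : ∀ i, G i 1 0 = G i 0 1 := fun i => by simpa using hG i 1 0
  have a02 : ∀ i, G i 2 0 = G i 0 2 := fun i => by simpa using hG i 2 0
  have a03 : ∀ i, G i 3 0 = G i 0 3 := fun i => by simpa using hG i 3 0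
  have a12 : ∀ i, G i 2 1 = -G i 1 2 := fun i => by simpa using hG i 2 1
  have a13 : ∀ i, G i 3 1 = -G i 1 3 := fun i => by simpa using hG i 3 1
  have a23 : ∀ i, G i 3 2 = -G i 2 3 := fun i => by simpa using hG i 3 2
  have b01 : ∀ m i, DG m i 1 0 = DG m i 0 1 := fun m i => by
    simpa using hDG m i 1 0
  have b02 : ∀ m i, DG m i 2 0 = DG m i 0 2 := fun m i => by
    simpa using hDG m i 2 0
  have b03 : ∀ m i, DG m i 3 0 = DG m i 0 3 := fun m i => by
    simpa using hDG m i 3 0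
  have b12 : ∀ m i, DG m i 2 1 = -DG m i 1 2 := fun m i => by
    simpa using hDG m i 2 1
  have b13 : ∀ m i, DG m i 3 1 = -DG m i 1 3 := fun m i => by
    simpa using hDG m i 3 1
  have b23 : ∀ m i, DG m i 3 2 = -DG m i 2 3 := fun m i => by
    simpa using hDG m i 3 2
  -- The antisymmetric part of the Ricci tensor is the trace of the Jacobi identity.
  have hJ0 := hJ 0 0 α β
  have hJ1 := hJ 1 1 α β
  have hJ2 := hJ 2 2 α β
  have hJ3 := hJ 3 3 α β
  simp only [Fin.sum_univ_four, torsionOf] at hJ0 hJ1 hJ2 hJ3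
  fin_cases α <;> fin_cases β <;>
    simp only [ricciOf, Fin.zero_eta, Fin.mk_one, Fin.reduceFinMk, Fin.sum_univ_four, torsionOf, h0,
      h1, a01, a02, a03, a12, a13, a23, b01, b02, b03, b12, b13, b23] at hJ0 hJ1 hJ2 hJ3 ⊢ <;>
    linear_combination hJ0 + hJ1 + hJ2 + hJ3

/-! ### The Lagrangian and its field momentum -/

/-- The pairing defined by the Lagrangian is symmetric. -/
theorem wedgePairing_dualSuperpotential_comm (t u : Fin 4 → Fin 4 → Fin 4 → ℝ)
    (ht : ∀ k i j, t k j i = -t k i j) (hu : ∀ k i j, u k j i = -u k i j) :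
    wedgePairing t (dualSuperpotential u) = wedgePairing u (dualSuperpotential t) := by
  have ht0 : ∀ k i, t k i i = 0 := fun k i => by linarith [ht k i i]
  have hu0 : ∀ k i, u k i i = 0 := fun k i => by linarith [hu k i i]
  have m0 : ∀ i j, i ≠ j → minkowski i j = 0 := fun i j h => if_neg h
  have m1 : ∀ i, minkowski i i = sgn i := fun i => if_pos rfl
  simp only [wedgePairing, Fin.sum_univ_four, dualSuperpotential, dualComponents_zero_one,
    dualComponents_zero_two, dualComponents_zero_three, dualComponents_one_two,
    dualComponents_one_three, dualComponents_two_three, superpotential, m1, m0, ne_eq,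
    Fin.reduceEq, not_false_eq_true, sgn_zero, sgn_one, sgn_two, sgn_three, ht0, hu0,
    ht _ 0 1, ht _ 0 2, ht _ 0 3, ht _ 1 2, ht _ 1 3, ht _ 2 3,
    hu _ 0 1, hu _ 0 2, hu _ 0 3, hu _ 1 2, hu _ 1 3, hu _ 2 3]
  ring

theorem superpotential_add_smul (t u : Fin 4 → Fin 4 → Fin 4 → ℝ) (s : ℝ) (α i j : Fin 4) :
    superpotential (t + s • u) α i j = superpotential t α i j + s * superpotential u α i j := by
  simp only [superpotential, Pi.add_apply, Pi.smul_apply, smul_eq_mul, Finset.sum_add_distrib,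
    ← Finset.mul_sum]
  ring

theorem dualSuperpotential_add_smul (t u : Fin 4 → Fin 4 → Fin 4 → ℝ) (s : ℝ) :
    dualSuperpotential (t + s • u) = dualSuperpotential t + s • dualSuperpotential u := by
  ext α i j
  simp only [dualSuperpotential, dualComponents, superpotential_add_smul, Pi.add_apply,
    Pi.smul_apply, smul_eq_mul, mul_add, add_mul, Finset.sum_add_distrib, Finset.mul_sum]
  congr 1
  refine Finset.sum_congr rfl fun a _ => Finset.sum_congr rfl fun b _ => ?_
  ring

theorem wedgePairing_add_smul_left (t u h : Fin 4 → Fin 4 → Fin 4 → ℝ) (s : ℝ) :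
    wedgePairing (t + s • u) h = wedgePairing t h + s * wedgePairing u h := by
  simp only [wedgePairing, Pi.add_apply, Pi.smul_apply, smul_eq_mul, Fin.sum_univ_four]
  ring

theorem wedgePairing_add_smul_right (t u h : Fin 4 → Fin 4 → Fin 4 → ℝ) (s : ℝ) :
    wedgePairing h (t + s • u) = wedgePairing h t + s * wedgePairing h u := by
  simp only [wedgePairing, Pi.add_apply, Pi.smul_apply, smul_eq_mul, Fin.sum_univ_four]
  ring

/-- Since the pairing is symmetric, the derivative of the quadratic form is twice the pairing. -/
theorem hasDerivAt_wedgePairing (t u : Fin 4 → Fin 4 → Fin 4 → ℝ)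
    (ht : ∀ k i j, t k j i = -t k i j) (hu : ∀ k i j, u k j i = -u k i j) :
    HasDerivAt (fun s : ℝ => wedgePairing (t + s • u) (dualSuperpotential (t + s • u)))
      (2 * wedgePairing u (dualSuperpotential t)) 0 := by
  have h : (fun s : ℝ => wedgePairing (t + s • u) (dualSuperpotential (t + s • u))) =
      fun s => wedgePairing t (dualSuperpotential t) +
        s * (2 * wedgePairing u (dualSuperpotential t))
        + s ^ 2 * wedgePairing u (dualSuperpotential u) := by
    ext s
    rw [dualSuperpotential_add_smul, wedgePairing_add_smul_left, wedgePairing_add_smul_right,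
      wedgePairing_add_smul_right, wedgePairing_dualSuperpotential_comm t u ht hu]
    ring
  rw [h]
  have h1 := ((hasDerivAt_id (0 : ℝ)).mul_const
      (2 * wedgePairing u (dualSuperpotential t))).const_add
    (wedgePairing t (dualSuperpotential t))
  have h2 := ((hasDerivAt_id (0 : ℝ)).pow 2).mul_const (wedgePairing u (dualSuperpotential u))
  exact (h1.add h2).congr_deriv (by simp)

section Frame

variable {V : Type*} [AddCommGroup V] [Module ℝ V]

/-- The components of a family of `2`-forms in a frame. -/
def frameComponents (e : Fin 4 → V) (T : Fin 4 → Form V 2) (k i j : Fin 4) : ℝ := T k ![e i, e j]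

theorem frameComponents_swap (e : Fin 4 → V) (T : Fin 4 → Form V 2) (k i j : Fin 4) :
    frameComponents e T k j i = -frameComponents e T k i j :=
  form_two_swap _ _ _

variable {e : Fin 4 → V} {ϑ : Fin 4 → V →ₗ[ℝ] ℝ}

theorem dualCombination_frame (hd : ∀ α β, ϑ α (e β) = if α = β then 1 else 0)
    (T : Fin 4 → Form V 2) (α i j : Fin 4) :
    dualCombination e ϑ T α ![e i, e j] = dualSuperpotential (frameComponents e T) α i j := by
  rw [dualCombination, hodge2_frame hd, dualSuperpotential]
  congr 1
  ext a b
  have hs : sgn α * sgn α = 1 := by fin_cases α <;> norm_num [sgn]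
  simp only [AlternatingMap.smul_apply, AlternatingMap.add_apply, AlternatingMap.neg_apply,
    AlternatingMap.sub_apply, tensorPart, vectorPart_frame hd, axialPart_frame hd, smul_eq_mul,
    superpotential, frameComponents, minkowski]
  -- The axial part carries `sgn α * sgn α = 1`, from raising and lowering `α`.
  split_ifs <;> linear_combination (1 / 2) * (sgn α * T α ![e a, e b] + sgn a * T a ![e b, e α]
    + sgn b * T b ![e α, e a]) * hs

theorem wedge_frame_eq_wedgePairing (T H : Fin 4 → Form V 2) :
    (∑ α, wedge (T α) (H α)) (fun i => e i) =
      wedgePairing (frameComponents e T) (frameComponents e H) := by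
  rw [form_sum_apply]
  exact Finset.sum_congr rfl fun α _ => wedge_two_two_apply _ _ _

theorem lagrangian_frame (hd : ∀ α β, ϑ α (e β) = if α = β then 1 else 0) (κ : ℝ)
    (T : Fin 4 → Form V 2) :
    lagrangian κ e ϑ T (fun i => e i) = -(1 / (2 * κ)) *
      wedgePairing (frameComponents e T) (dualSuperpotential (frameComponents e T)) := by
  have h : frameComponents e (dualCombination e ϑ T) =
      dualSuperpotential (frameComponents e T) := by
    ext α i j; exact dualCombination_frame hd T α i j
  rw [← h, ← wedge_frame_eq_wedgePairing]
  rfl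

theorem excitation_frame (hd : ∀ α β, ϑ α (e β) = if α = β then 1 else 0) (κ : ℝ)
    (T : Fin 4 → Form V 2) (α i j : Fin 4) :
    excitation κ e ϑ T α ![e i, e j] =
      1 / κ * dualSuperpotential (frameComponents e T) α i j := by
  rw [← dualCombination_frame hd]; rfl

/-- A top-degree form is determined by its value on the frame. -/
theorem form_four_eq_smul_volumeForm (b : Module.Basis (Fin 4) ℝ V)
    (hd : ∀ α β, ϑ α (b β) = if α = β then 1 else 0) (f : Form V 4) :
    f = f (fun i => b i) • volumeForm ϑ := by
  have h := (volumeForm ϑ).eq_smul_basis_det b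
  have h1 : volumeForm ϑ b = 1 := by
    have h2 : (b : Fin 4 → V) = ![b 0, b 1, b 2, b 3] := by
      ext i; fin_cases i <;> rfl
    rw [h2, volumeForm_frame hd]
    simp [leviCivita]
  rw [h1, one_smul] at h
  rw [h]
  exact f.eq_smul_basis_det b

/-- Two `3`-forms agree if they agree on increasing triples of frame vectors. -/
theorem form_three_ext (b : Module.Basis (Fin 4) ℝ V) {f g : Form V 3}
    (h : ∀ i j k : Fin 4, i < j → j < k → f ![b i, b j, b k] = g ![b i, b j, b k]) : f = g := by
  refine b.ext_alternating fun v hv => ?_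
  have hmono : StrictMono (v ∘ Tuple.sort v) :=
    (Tuple.monotone_sort v).strictMono_of_injective (hv.comp (Equiv.injective _))
  have hc : (fun i => b (v i)) ∘ Tuple.sort v =
      ![b ((v ∘ Tuple.sort v) 0), b ((v ∘ Tuple.sort v) 1), b ((v ∘ Tuple.sort v) 2)] := by
    ext i; fin_cases i <;> rfl
  have hf := f.map_perm (fun i => b (v i)) (Tuple.sort v)
  have hg := g.map_perm (fun i => b (v i)) (Tuple.sort v)
  rw [hc] at hf hg
  rw [h _ _ _ (hmono (by decide)) (hmono (by decide)), hg] at hf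
  rcases Int.units_eq_one_or (Equiv.Perm.sign (Tuple.sort v)) with hs | hs <;>
    simpa [hs] using hf.symm

/-- The excitation is the negative derivative of the Lagrangian. -/
theorem hasDerivAt_lagrangian (b : Module.Basis (Fin 4) ℝ V)
    (hd : ∀ α β, ϑ α (b β) = if α = β then 1 else 0) {κ : ℝ} (T τ : Fin 4 → Form V 2)
    (v : Fin 4 → V) :
    HasDerivAt (fun s : ℝ => lagrangian κ b ϑ (fun α => T α + s • τ α) v)
      (-∑ α, wedge (τ α) (excitation κ b ϑ T α) v) 0 := by
  have hvol : ∀ f : Form V 4, f v = f (fun i => b i) * volumeForm ϑ v := fun f => by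
    conv_lhs => rw [form_four_eq_smul_volumeForm b hd f]
    rfl
  have hcomp : ∀ s : ℝ, frameComponents b (fun α => T α + s • τ α) =
      frameComponents b T + s • frameComponents b τ := fun s => rfl
  have hexc : frameComponents b (excitation κ b ϑ T) =
      0 + (1 / κ) • dualSuperpotential (frameComponents b T) := by
    ext α i j
    rw [zero_add]
    exact excitation_frame hd κ T α i j
  have hder : (-∑ α, wedge (τ α) (excitation κ b ϑ T α) v) = -(1 / (2 * κ)) *
      (2 * wedgePairing (frameComponents b τ) (dualSuperpotential (frameComponents b T)))
        * volumeForm ϑ v := by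
    have h1 : ∑ α, wedge (τ α) (excitation κ b ϑ T α) v =
      (∑ α, wedge (τ α) (excitation κ b ϑ T α)) v := (form_sum_apply _ _ _).symm
    have h2 := wedge_frame_eq_wedgePairing (e := b) τ (excitation κ b ϑ T)
    rw [hexc, wedgePairing_add_smul_right] at h2
    have h0 : wedgePairing (frameComponents b τ) 0 = 0 := by simp [wedgePairing]
    rw [h1, hvol, h2, h0]
    ring
  have hfun : (fun s : ℝ => lagrangian κ b ϑ (fun α => T α + s • τ α) v) = fun s : ℝ =>
      -(1 / (2 * κ)) * wedgePairing (frameComponents b T + s • frameComponents b τ)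
        (dualSuperpotential (frameComponents b T + s • frameComponents b τ)) * volumeForm ϑ v := by
    ext s
    rw [hvol, lagrangian_frame hd, hcomp]
  rw [hder, hfun]
  exact ((hasDerivAt_wedgePairing _ _ (frameComponents_swap _ _)
    (frameComponents_swap _ _)).const_mul _).mul_const _

end Frame

section Manifold

variable {M : Type*} [TopologicalSpace M] [ChartedSpace E4 M]

/-! ### Derivatives of functions and brackets of combinations -/

theorem mvfderiv_clm_comp {E F : Type*} [NormedAddCommGroup E] [NormedSpace ℝ E]
    [NormedAddCommGroup F] [NormedSpace ℝ F] (L : E →L[ℝ] F) {f : M → E} {x : M}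
    (hf : MDifferentiableAt (𝓡 4) 𝓘(ℝ, E) f x) (v : TangentSpace (𝓡 4) x) :
    mvfderiv (𝓡 4) (fun y => L (f y)) x v = L (mvfderiv (𝓡 4) f x v) := by
  have h := (L.hasMFDerivAt (x := f x)).comp x hf.hasMFDerivAt
  have h2 := h.mfderiv
  simp only [mvfderiv]
  change _ = L (mfderiv (𝓡 4) 𝓘(ℝ, E) f x v)
  change mfderiv (𝓡 4) 𝓘(ℝ, F) (L ∘ f) x v = _
  rw [h2]
  rfl

theorem mvfderiv_congr {f h : M → ℝ} {x : M} (hfh : f =ᶠ[nhds x] h) :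
    mvfderiv (𝓡 4) f x = mvfderiv (𝓡 4) h x := by
  ext v
  change mfderiv (𝓡 4) 𝓘(ℝ, ℝ) f x v = mfderiv (𝓡 4) 𝓘(ℝ, ℝ) h x v
  rw [hfh.mfderiv_eq]
  rfl

theorem mdifferentiableAt_pi_space {ι : Type*} [Fintype ι] {F : ι → Type*}
    [∀ i, NormedAddCommGroup (F i)] [∀ i, NormedSpace ℝ (F i)] {f : M → ∀ i, F i} {x : M}
    (hf : ∀ i, MDifferentiableAt (𝓡 4) 𝓘(ℝ, F i) (fun y => f y i) x) :
    MDifferentiableAt (𝓡 4) 𝓘(ℝ, ∀ i, F i) f x := by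
  simp only [mdifferentiableAt_iff] at hf ⊢
  exact ⟨continuousAt_pi.2 fun i => (hf i).1, differentiableWithinAt_pi.2 fun i => (hf i).2⟩

theorem mvfderiv_linear_components (L : (Fin 4 → Fin 4 → Fin 4 → ℝ) →ₗ[ℝ] ℝ)
    {f : Fin 4 → Fin 4 → Fin 4 → M → ℝ} {x : M}
    (hf : ∀ i j k, MDifferentiableAt (𝓡 4) 𝓘(ℝ, ℝ) (f i j k) x) (v : TangentSpace (𝓡 4) x) :
    MDifferentiableAt (𝓡 4) 𝓘(ℝ, ℝ) (fun y => L fun i j k => f i j k y) x ∧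
    mvfderiv (𝓡 4) (fun y => L fun i j k => f i j k y) x v =
      L fun i j k => mvfderiv (𝓡 4) (f i j k) x v := by
  have hF : MDifferentiableAt (𝓡 4) 𝓘(ℝ, Fin 4 → Fin 4 → Fin 4 → ℝ)
      (fun y i j k => f i j k y) x :=
    mdifferentiableAt_pi_space fun i => mdifferentiableAt_pi_space fun j =>
      mdifferentiableAt_pi_space fun k => hf i j k
  refine ⟨(L.toContinuousLinearMap.mdifferentiableAt).comp x hF, ?_⟩
  refine (mvfderiv_clm_comp L.toContinuousLinearMap hF v).trans ?_
  change L _ = _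
  congr 1
  ext i j k
  have h := mvfderiv_clm_comp ((ContinuousLinearMap.proj k).comp ((ContinuousLinearMap.proj j).comp
    (ContinuousLinearMap.proj (R := ℝ) (φ := fun _ : Fin 4 => Fin 4 → Fin 4 → ℝ) i))) hF v
  exact h.symm

variable [IsManifold (𝓡 4) ∞ M]

theorem diffAt_smul {f : M → ℝ} {Y : VField M} {x : M}
    (hf : MDifferentiableAt (𝓡 4) 𝓘(ℝ, ℝ) f x) (hY : DiffAt Y x) :
    DiffAt (fun y => f y • Y y) x :=
  hf.smul_section hY

theorem diffAt_sum {ι : Type*} {s : Finset ι} {Y : ι → VField M} {x : M}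
    (hY : ∀ i ∈ s, DiffAt (Y i) x) : DiffAt (fun y => ∑ i ∈ s, Y i y) x :=
  MDifferentiableAt.sum_section hY

theorem mlieBracket_sum_smul {ι : Type*} (s : Finset ι) (Y : VField M) {Z : ι → VField M}
    {f : ι → M → ℝ} {x : M} (hf : ∀ i ∈ s, MDifferentiableAt (𝓡 4) 𝓘(ℝ, ℝ) (f i) x)
    (hZ : ∀ i ∈ s, DiffAt (Z i) x) :
    VectorField.mlieBracket (𝓡 4) Y (fun y => ∑ i ∈ s, f i y • Z i y) x =
      ∑ i ∈ s, (mvfderiv (𝓡 4) (f i) x (Y x) • Z i x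
        + f i x • VectorField.mlieBracket (𝓡 4) Y (Z i) x) := by
  classical
  induction s using Finset.induction_on with
  | empty =>
    simp only [Finset.sum_empty]
    exact congrFun (VectorField.mlieBracket_zero_right (W := Y)) x
  | insert a s ha ih =>
    simp only [Finset.sum_insert ha]
    have h1 := hZ a (Finset.mem_insert_self a s)
    have h2 := hf a (Finset.mem_insert_self a s)
    have h3 : DiffAt (fun y => ∑ i ∈ s, f i y • Z i y) x := diffAt_sum fun i hi =>
      diffAt_smul (hf i (Finset.mem_insert_of_mem hi)) (hZ i (Finset.mem_insert_of_mem hi))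
    rw [← ih (fun i hi => hf i (Finset.mem_insert_of_mem hi))
      (fun i hi => hZ i (Finset.mem_insert_of_mem hi)),
      ← VectorField.mlieBracket_smul_right h2 h1]
    exact VectorField.mlieBracket_add_right (diffAt_smul h2 h1) h3

theorem cov_sum_smul {cov : Conn M} {U : Set M} (hcov : IsCovariantDerivativeOn E4 cov U)
    {ι : Type*} (s : Finset ι) {Z : ι → VField M}
    {f : ι → M → ℝ} {x : M} (hx : x ∈ U) (hf : ∀ i ∈ s, MDifferentiableAt (𝓡 4) 𝓘(ℝ, ℝ) (f i) x)
    (hZ : ∀ i ∈ s, DiffAt (Z i) x) (v : TangentSpace (𝓡 4) x) :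
    cov (fun y => ∑ i ∈ s, f i y • Z i y) x v =
      ∑ i ∈ s, (mvfderiv (𝓡 4) (f i) x v • Z i x + f i x • cov (Z i) x v) := by
  classical
  induction s using Finset.induction_on with
  | empty =>
    simp only [Finset.sum_empty]
    exact congrArg (fun L => L v) (hcov.zero hx)
  | insert a s ha ih =>
    simp only [Finset.sum_insert ha]
    have h1 := hZ a (Finset.mem_insert_self a s)
    have h2 := hf a (Finset.mem_insert_self a s)
    have h3 : DiffAt (fun y => ∑ i ∈ s, f i y • Z i y) x := diffAt_sum fun i hi =>
      diffAt_smul (hf i (Finset.mem_insert_of_mem hi)) (hZ i (Finset.mem_insert_of_mem hi))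
    rw [← ih (fun i hi => hf i (Finset.mem_insert_of_mem hi))
      (fun i hi => hZ i (Finset.mem_insert_of_mem hi))]
    have h4 := congrArg (fun L => L v) (hcov.add (diffAt_smul h2 h1) h3 hx)
    have h5 := congrArg (fun L => L v) (hcov.leibniz h1 h2 hx)
    refine h4.trans ?_
    refine (congrArg (· + _) h5).trans ?_
    simp [add_comm]

/-! ### The frame and its coframe -/

variable {g : LorentzMetric M} {e : Fin 4 → VField M} {U : Set M}

theorem SmoothOn.contMDiffAt {X : VField M} (hX : SmoothOn X U) (hU : IsOpen U) {x : M}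
    (hx : x ∈ U) : ContMDiffAt (𝓡 4) (𝓡 4).tangent ∞
      (fun y => (⟨y, X y⟩ : TangentBundle (𝓡 4) M)) x :=
  ContMDiffOn.contMDiffAt hX (hU.mem_nhds hx)

theorem SmoothOn.diffAt {X : VField M} (hX : SmoothOn X U) (hU : IsOpen U) {x : M}
    (hx : x ∈ U) : DiffAt X x :=
  (hX.contMDiffAt hU hx).mdifferentiableAt (by simp)

/-- The frame as a basis of the tangent space. -/
theorem exists_frame_basis (he : IsTetradOn g e U) {x : M} (hx : x ∈ U) :
    ∃ b : Module.Basis (Fin 4) ℝ (TangentSpace (𝓡 4) x), ⇑b = fun α => e α x := by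
  have hli : LinearIndependent ℝ fun α => e α x := by
    rw [Fintype.linearIndependent_iff]
    intro c hc i
    have h := congrArg (coframe g e x i) hc
    simpa [coframe_apply_frame he hx] using h
  have hfr : Module.finrank ℝ (TangentSpace (𝓡 4) x) = 4 := by
    change Module.finrank ℝ E4 = 4
    simp
  exact ⟨basisOfLinearIndependentOfCardEqFinrank hli (by simp [hfr]), by simp⟩

theorem sum_coframe_smul_frame (he : IsTetradOn g e U) {x : M} (hx : x ∈ U)
    (v : TangentSpace (𝓡 4) x) : ∑ k, coframe g e x k v • e k x = v := by
  obtain ⟨b, hb⟩ := exists_frame_basis he hx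
  have hb' : ∀ k, e k x = b k := fun k => (congrFun hb k).symm
  have h : ∀ k, coframe g e x k v = b.repr v k := by
    intro k
    conv_lhs => rw [← b.sum_repr v]
    simp [← hb', coframe_apply_frame he hx]
  simp only [h, hb', b.sum_repr]

theorem mdifferentiableAt_coframe (he : IsTetradOn g e U) (hU : IsOpen U) {Y : VField M} {x : M}
    (hx : x ∈ U) (hY : DiffAt Y x) (k : Fin 4) :
    MDifferentiableAt (𝓡 4) 𝓘(ℝ, ℝ) (fun y => coframe g e y k (Y y)) x := by
  have h1 : MDifferentiableAt (𝓡 4) ((𝓡 4).prod 𝓘(ℝ, ℝ))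
      (fun y => Bundle.TotalSpace.mk' ℝ (E := Bundle.Trivial M ℝ) y
        (g.inner y (e k y) (Y y))) x := by
    apply MDifferentiableAt.clm_bundle_apply₂ (F₁ := E4) (F₂ := E4)
    · exact (g.contMDiff x).mdifferentiableAt (by simp)
    · exact (he.smooth k).diffAt hU hx
    · exact hY
  simp only [mdifferentiableAt_totalSpace] at h1
  exact h1.2.const_smul (sgn k)

end Manifold

section Manifold

variable {M : Type*} [TopologicalSpace M] [ChartedSpace E4 M] [IsManifold (𝓡 4) ∞ M]

/-! ### Structure functions of the frame and the Jacobi identity -/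

/-- The torsion components `T^k (e_i, e_j) = -ϑ^k ([e_i, e_j])` of the Weitzenböck connection. -/
def frameTorsion (g : LorentzMetric M) (e : Fin 4 → VField M) (k i j : Fin 4) (x : M) : ℝ :=
  -coframe g e x k (VectorField.mlieBracket (𝓡 4) (e i) (e j) x)

/-- The frame derivatives `e_m (f_{ijk})` of a family of functions. -/
def frameDeriv (e : Fin 4 → VField M) (f : Fin 4 → Fin 4 → Fin 4 → M → ℝ) (x : M)
    (m i j k : Fin 4) : ℝ :=
  mvfderiv (𝓡 4) (f i j k) x (e m x)

variable {g : LorentzMetric M} {e : Fin 4 → VField M} {U : Set M}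

theorem frameTorsion_swap (k i j : Fin 4) (x : M) :
    frameTorsion g e k j i x = -frameTorsion g e k i j x := by
  rw [frameTorsion, VectorField.mlieBracket_swap_apply, map_neg, frameTorsion]

theorem mlieBracket_frame (he : IsTetradOn g e U) {x : M} (hx : x ∈ U) (i j : Fin 4) :
    VectorField.mlieBracket (𝓡 4) (e i) (e j) x = ∑ l, (-frameTorsion g e l i j x) • e l x := by
  conv_lhs => rw [← sum_coframe_smul_frame he hx (VectorField.mlieBracket (𝓡 4) (e i) (e j) x)]
  simp [frameTorsion]

theorem coframe_sum_smul (he : IsTetradOn g e U) {x : M} (hx : x ∈ U) (c : Fin 4 → ℝ)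
    (k : Fin 4) : coframe g e x k (∑ l, c l • e l x) = c k := by
  simp [coframe_apply_frame he hx]

theorem diffAt_mlieBracket_frame (he : IsTetradOn g e U) (hU : IsOpen U) {x : M}
    (hx : x ∈ U) (i j : Fin 4) : DiffAt (VectorField.mlieBracket (𝓡 4) (e i) (e j)) x := by
  -- Over `ℝ` the threshold `minSmoothness ℝ n` is `n`.
  have h2 : ∀ i, ContMDiffAt (𝓡 4) (𝓡 4).tangent ((2 : ℕ∞) : WithTop ℕ∞)
      (fun y => (⟨y, e i y⟩ : TangentBundle (𝓡 4) M)) x := fun i =>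
    ((he.smooth i).contMDiffAt hU hx).of_le (by exact_mod_cast le_top)
  have : IsManifold (𝓡 4) (((2 : ℕ∞) : WithTop ℕ∞) + 1) M :=
    IsManifold.of_le (n := ∞) (by exact_mod_cast le_top)
  have : IsManifold (𝓡 4) (minSmoothness ℝ 2) M :=
    IsManifold.of_le (n := ∞) (by
      rw [minSmoothness_of_isRCLikeNormedField]; exact ENat.LEInfty.out)
  have h3 := ContMDiffAt.mlieBracket_vectorField (m := 1) (n := 2) (h2 i) (h2 j)
    (by rw [minSmoothness_of_isRCLikeNormedField]; norm_num)
  exact h3.mdifferentiableAt (by simp)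

theorem mdifferentiableAt_frameTorsion (he : IsTetradOn g e U) (hU : IsOpen U) {x : M}
    (hx : x ∈ U) (k i j : Fin 4) :
    MDifferentiableAt (𝓡 4) 𝓘(ℝ, ℝ) (frameTorsion g e k i j) x :=
  (mdifferentiableAt_coframe he hU hx (diffAt_mlieBracket_frame he hU hx i j) k).neg

theorem coframe_mlieBracket_mlieBracket (he : IsTetradOn g e U) (hU : IsOpen U) {x : M}
    (hx : x ∈ U) (p k i j : Fin 4) :
    coframe g e x p (VectorField.mlieBracket (𝓡 4) (e k)
      (VectorField.mlieBracket (𝓡 4) (e i) (e j)) x) =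
      -frameDeriv e (frameTorsion g e) x k p i j
        + ∑ l, frameTorsion g e l i j x * frameTorsion g e p k l x := by
  have h : VectorField.mlieBracket (𝓡 4) (e i) (e j) =ᶠ[nhds x]
      fun y => ∑ l, (-frameTorsion g e l i j y) • e l y :=
    Filter.eventually_of_mem (hU.mem_nhds hx) fun y hy => mlieBracket_frame he hy i j
  have hb := Filter.EventuallyEq.mlieBracket_vectorField_eq (I := 𝓡 4)
    (Filter.EventuallyEq.refl (nhds x) (e k)) h
  have hb' := mlieBracket_sum_smul (f := fun l y => -frameTorsion g e l i j y) Finset.univ (e k)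
    (fun l _ => (mdifferentiableAt_frameTorsion he hU hx l i j).neg)
    (fun l _ => (he.smooth l).diffAt hU hx)
  rw [hb.trans hb']
  have hd : ∀ l, mvfderiv (𝓡 4) (fun y => -frameTorsion g e l i j y) x (e k x) =
      -frameDeriv e (frameTorsion g e) x k l i j := fun l => by
    have := mvfderiv_neg (I := 𝓡 4) (g := frameTorsion g e l i j) (x := x)
    exact congrArg (fun L => L (e k x)) this
  rw [Finset.sum_add_distrib, map_add]
  simp only [hd]
  rw [coframe_sum_smul he hx (fun l => -frameDeriv e (frameTorsion g e) x k l i j), map_sum]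
  congr 1
  refine Finset.sum_congr rfl fun l _ => ?_
  rw [map_smul, frameTorsion, frameTorsion, smul_eq_mul]
  ring

/-- The Jacobi identity for the frame vector fields. -/
theorem frameTorsion_jacobi (he : IsTetradOn g e U) (hU : IsOpen U) {x : M}
    (hx : x ∈ U) (l i j k : Fin 4) :
    frameDeriv e (frameTorsion g e) x k l i j + frameDeriv e (frameTorsion g e) x i l j k
      + frameDeriv e (frameTorsion g e) x j l k i
      + ∑ m, (frameTorsion g e m i j x * frameTorsion g e l m k x
        + frameTorsion g e m j k x * frameTorsion g e l m i x
        + frameTorsion g e m k i x * frameTorsion g e l m j x) = 0 := by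
  have h2 : ∀ i, ContMDiffAt (𝓡 4) (𝓡 4).tangent (minSmoothness ℝ 2)
      (fun y => (⟨y, e i y⟩ : TangentBundle (𝓡 4) M)) x := fun i =>
    ((he.smooth i).contMDiffAt hU hx).of_le (by
      rw [minSmoothness_of_isRCLikeNormedField]; exact ENat.LEInfty.out)
  have : IsManifold (𝓡 4) (minSmoothness ℝ 3) M :=
    IsManifold.of_le (n := ∞) (by
      rw [minSmoothness_of_isRCLikeNormedField]; exact ENat.LEInfty.out)
  have h := VectorField.leibniz_identity_mlieBracket_apply (h2 i) (h2 j) (h2 k)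
  rw [VectorField.mlieBracket_swap_apply (V := VectorField.mlieBracket (𝓡 4) (e i) (e j)),
    VectorField.mlieBracket_swap (V := e i) (W := e k)] at h
  have hn : VectorField.mlieBracket (𝓡 4) (e j) (-VectorField.mlieBracket (𝓡 4) (e k) (e i)) x =
      -VectorField.mlieBracket (𝓡 4) (e j) (VectorField.mlieBracket (𝓡 4) (e k) (e i)) x := by
    have h1 := VectorField.mlieBracket_const_smul_right (I := 𝓡 4) (V := e j) (c := (-1 : ℝ))
      (diffAt_mlieBracket_frame he hU hx k i)
    rwa [neg_one_smul, neg_one_smul] at h1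
  rw [hn] at h
  have h' := congrArg (coframe g e x l) h
  simp only [map_add, map_neg, coframe_mlieBracket_mlieBracket he hU hx] at h'
  simp only [Finset.sum_add_distrib]
  have hs : ∀ a (c : Fin 4 → ℝ), ∑ m, c m * frameTorsion g e l m a x =
      -∑ m, c m * frameTorsion g e l a m x := fun a c => by
    rw [← Finset.sum_neg_distrib]
    exact Finset.sum_congr rfl fun m _ => by rw [frameTorsion_swap]; ring
  rw [hs k, hs i, hs j]
  linarith

/-! ### The Levi-Civita connection in the frame -/

/-- The connection coefficients `ϑ^k (∇_{e_i} e_j)`. -/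
def connectionCoefficient (g : LorentzMetric M) (e : Fin 4 → VField M) (cov : Conn M)
    (i j k : Fin 4) (x : M) : ℝ :=
  coframe g e x k (cov (e j) x (e i x))

variable {cov : Conn M}

theorem cov_frame (he : IsTetradOn g e U) {x : M} (hx : x ∈ U) (i j : Fin 4) :
    cov (e j) x (e i x) = ∑ k, connectionCoefficient g e cov i j k x • e k x :=
  (sum_coframe_smul_frame he hx _).symm

theorem frameTorsion_eq_torsionOf (he : IsTetradOn g e U) (hU : IsOpen U)
    (hLC : IsLeviCivitaOn g cov U) {x : M} (hx : x ∈ U) (k i j : Fin 4) :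
    frameTorsion g e k i j x = torsionOf (connectionCoefficient g e cov · · · x) k i j := by
  have h := hLC.torsion_free x hx (e i) (e j) ((he.smooth i).diffAt hU hx)
    ((he.smooth j).diffAt hU hx)
  have h' := congrArg (coframe g e x k) h
  simp only [torsion, map_sub, map_zero] at h'
  simp only [frameTorsion, torsionOf, connectionCoefficient]
  linarith

theorem connectionCoefficient_antisymm (he : IsTetradOn g e U) (hU : IsOpen U)
    (hLC : IsLeviCivitaOn g cov U) {x : M} (hx : x ∈ U) (i j k : Fin 4) :
    sgn k * connectionCoefficient g e cov i j k x =
      -(sgn j * connectionCoefficient g e cov i k j x) := by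
  have h := hLC.metric x hx (e j) (e k) ((he.smooth j).diffAt hU hx)
    ((he.smooth k).diffAt hU hx) (e i x)
  have hc : (fun y => g.inner y (e j y) (e k y)) =ᶠ[nhds x] fun _ => minkowski j k :=
    Filter.eventually_of_mem (hU.mem_nhds hx) fun y hy => he.orthonormal y hy j k
  have h0 : mvfderiv (𝓡 4) (fun _ : M => minkowski j k) x (e i x) = 0 := by
    rw [mvfderiv_const]; rfl
  rw [mvfderiv_congr hc, h0, g.symm x (cov (e j) x (e i x))] at h
  have hs : ∀ a, sgn a * sgn a = 1 := fun a => by fin_cases a <;> norm_num [sgn]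
  simp only [connectionCoefficient, coframe, LinearMap.smul_apply, ContinuousLinearMap.coe_coe,
    smul_eq_mul, ← mul_assoc, hs, one_mul]
  linarith

/-- Koszul's formula in the frame. -/
theorem connectionCoefficient_eq (he : IsTetradOn g e U) (hU : IsOpen U)
    (hLC : IsLeviCivitaOn g cov U) {x : M} (hx : x ∈ U) (α j i : Fin 4) :
    connectionCoefficient g e cov α j i x = sgn i * (-(sgn α * frameTorsion g e α i j x)
      + 1 / 2 * (sgn α * frameTorsion g e α i j x + sgn i * frameTorsion g e i j α x
        + sgn j * frameTorsion g e j α i x)) := by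
  have hs : sgn i * sgn i = 1 := by fin_cases i <;> norm_num [sgn]
  have hG := connectionCoefficient_antisymm he hU hLC hx
  simp only [frameTorsion_eq_torsionOf he hU hLC hx, torsionOf]
  linear_combination -(connectionCoefficient g e cov α j i x) * hs
    - sgn i * ((-1 / 2) * hG j i α + (1 / 2) * hG i j α - (1 / 2) * hG α i j)

theorem mdifferentiableAt_connectionCoefficient (he : IsTetradOn g e U) (hU : IsOpen U)
    (hLC : IsLeviCivitaOn g cov U) {x : M} (hx : x ∈ U) (i j k : Fin 4) :
    MDifferentiableAt (𝓡 4) 𝓘(ℝ, ℝ) (connectionCoefficient g e cov i j k) x := by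
  have h : connectionCoefficient g e cov i j k =ᶠ[nhds x] fun y =>
      sgn k * (-(sgn i * frameTorsion g e i k j y)
      + 1 / 2 * (sgn i * frameTorsion g e i k j y + sgn k * frameTorsion g e k j i y
        + sgn j * frameTorsion g e j i k y)) :=
    Filter.eventually_of_mem (hU.mem_nhds hx) fun y hy =>
      connectionCoefficient_eq he hU hLC hy i j k
  have ht := mdifferentiableAt_frameTorsion he hU hx
  refine MDifferentiableAt.congr_of_eventuallyEq ?_ h
  exact ((((ht i k j).const_smul (sgn i)).neg).add (((((ht i k j).const_smul (sgn i)).add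
    ((ht k j i).const_smul (sgn k))).add ((ht j i k).const_smul (sgn j))).const_smul
      (1 / 2 : ℝ))).const_smul (sgn k)

theorem frameDeriv_frameTorsion (he : IsTetradOn g e U) (hU : IsOpen U)
    (hLC : IsLeviCivitaOn g cov U) {x : M} (hx : x ∈ U) (m : Fin 4) :
    frameDeriv e (frameTorsion g e) x m =
      torsionOf (frameDeriv e (connectionCoefficient g e cov) x m) := by
  ext k i j
  have hG := mdifferentiableAt_connectionCoefficient he hU hLC hx
  have h : frameTorsion g e k i j =ᶠ[nhds x] fun y =>
      connectionCoefficient g e cov j i k y - connectionCoefficient g e cov i j k y :=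
    Filter.eventually_of_mem (hU.mem_nhds hx) fun y hy =>
      frameTorsion_eq_torsionOf he hU hLC hy k i j
  rw [frameDeriv, mvfderiv_congr h, mvfderiv_fun_sub (hG j i k) (hG i j k)]
  rfl

theorem frameDeriv_connectionCoefficient_antisymm (he : IsTetradOn g e U) (hU : IsOpen U)
    (hLC : IsLeviCivitaOn g cov U) {x : M} (hx : x ∈ U) (m i j k : Fin 4) :
    sgn k * frameDeriv e (connectionCoefficient g e cov) x m i j k =
      -(sgn j * frameDeriv e (connectionCoefficient g e cov) x m i k j) := by
  have hG := mdifferentiableAt_connectionCoefficient he hU hLC hx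
  have h : (fun y => sgn k * connectionCoefficient g e cov i j k y) =ᶠ[nhds x] fun y =>
      -(sgn j * connectionCoefficient g e cov i k j y) :=
    Filter.eventually_of_mem (hU.mem_nhds hx) fun y hy =>
      connectionCoefficient_antisymm he hU hLC hy i j k
  have h2 := congrArg (fun L => L (e m x)) (mvfderiv_congr h)
  have hc : ∀ (c : ℝ) i j k, mvfderiv (𝓡 4) (fun y => c * connectionCoefficient g e cov i j k y) x
      (e m x) = c * mvfderiv (𝓡 4) (connectionCoefficient g e cov i j k) x (e m x) :=
    fun c i j k => mvfderiv_clm_comp (ContinuousLinearMap.mul ℝ ℝ c) (hG i j k) (e m x)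
  rw [mvfderiv_fun_neg] at h2
  simp only [neg_apply] at h2
  rw [hc, hc] at h2
  exact h2

theorem cov_cov_frame (he : IsTetradOn g e U) (hU : IsOpen U)
    (hLC : IsLeviCivitaOn g cov U) {x : M} (hx : x ∈ U) (γ β α k : Fin 4) :
    coframe g e x k (cov (fun y => cov (e α) y (e β y)) x (e γ x)) =
      frameDeriv e (connectionCoefficient g e cov) x γ β α k
        + ∑ l, connectionCoefficient g e cov β α l x * connectionCoefficient g e cov γ l k x := by
  have hG := mdifferentiableAt_connectionCoefficient he hU hLC hx
  have hfr := fun l => (he.smooth l).diffAt hU hx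
  have hd : DiffAt (fun y => ∑ l, connectionCoefficient g e cov β α l y • e l y) x :=
    diffAt_sum fun l _ => diffAt_smul (hG β α l) (hfr l)
  have h : ∀ᶠ y in nhds x, cov (e α) y (e β y) =
      ∑ l, connectionCoefficient g e cov β α l y • e l y :=
    Filter.eventually_of_mem (hU.mem_nhds hx) fun y hy => cov_frame he hy β α
  have hd' : DiffAt (fun y => cov (e α) y (e β y)) x :=
    MDifferentiableAt.congr_of_eventuallyEq hd (h.mono fun y hy => by
      simp only [hy])
  rw [hLC.isCovariantDerivativeOn.congr_of_eventuallyEq hd' hd (hU.mem_nhds hx) h,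
    cov_sum_smul hLC.isCovariantDerivativeOn _ hx (fun l _ => hG β α l) (fun l _ => hfr l),
    Finset.sum_add_distrib, map_add, coframe_sum_smul he hx
      (fun l => mvfderiv (𝓡 4) (connectionCoefficient g e cov β α l) x (e γ x)), map_sum]
  congr 1
  exact Finset.sum_congr rfl fun l _ => map_smul _ _ _

theorem coframe_curvature (he : IsTetradOn g e U) (hU : IsOpen U)
    (hLC : IsLeviCivitaOn g cov U) {x : M} (hx : x ∈ U) (γ β α k : Fin 4) :
    coframe g e x k (curvature cov (e γ) (e β) (e α) x) =
      frameDeriv e (connectionCoefficient g e cov) x γ β α k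
        - frameDeriv e (connectionCoefficient g e cov) x β γ α k
        + ∑ l, (connectionCoefficient g e cov β α l x * connectionCoefficient g e cov γ l k x
          - connectionCoefficient g e cov γ α l x * connectionCoefficient g e cov β l k x
          + torsionOf (connectionCoefficient g e cov · · · x) l γ β
            * connectionCoefficient g e cov l α k x) := by
  have h : coframe g e x k (cov (e α) x (VectorField.mlieBracket (𝓡 4) (e γ) (e β) x)) =
      -∑ l, torsionOf (connectionCoefficient g e cov · · · x) l γ β
        * connectionCoefficient g e cov l α k x := by
    rw [mlieBracket_frame he hx, map_sum, map_sum, ← Finset.sum_neg_distrib]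
    refine Finset.sum_congr rfl fun l _ => ?_
    rw [map_smul, map_smul, frameTorsion_eq_torsionOf he hU hLC hx, smul_eq_mul, neg_mul]
    rfl
  simp only [curvature, map_sub, cov_cov_frame he hU hLC hx, h, Finset.sum_add_distrib,
    Finset.sum_sub_distrib]
  ring

theorem ricci_eq_ricciOf (he : IsTetradOn g e U) (hU : IsOpen U)
    (hLC : IsLeviCivitaOn g cov U) {x : M} (hx : x ∈ U) (α β : Fin 4) :
    ricci g e cov α β x = ricciOf (connectionCoefficient g e cov · · · x)
      (frameDeriv e (connectionCoefficient g e cov) x) α β :=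
  Finset.sum_congr rfl fun γ _ => coframe_curvature he hU hLC hx γ β α γ

theorem einstein_eq_einsteinOf (he : IsTetradOn g e U) (hU : IsOpen U)
    (hLC : IsLeviCivitaOn g cov U) {x : M} (hx : x ∈ U) (α β : Fin 4) :
    einstein g e cov α β x = einsteinOf (connectionCoefficient g e cov · · · x)
      (frameDeriv e (connectionCoefficient g e cov) x) β α := by
  -- The Ricci tensor is symmetric, which interchanges the two indices.
  have hJ := frameTorsion_jacobi he hU hx
  simp only [frameDeriv_frameTorsion he hU hLC hx, frameTorsion_eq_torsionOf he hU hLC hx] at hJ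
  have hsymm := ricciOf_comm _ _ (connectionCoefficient_antisymm he hU hLC hx)
    (frameDeriv_connectionCoefficient_antisymm he hU hLC hx) hJ β α
  have hm : minkowski α β = minkowski β α := by
    rcases eq_or_ne α β with rfl | h
    · rfl
    · simp [minkowski, h, h.symm]
  rw [einstein, einsteinOf, hm, hsymm]
  simp only [scalarCurvature, ricci_eq_ricciOf he hU hLC hx]

end Manifold

/-! ### The exterior derivative in the frame -/

section Pointwise

variable {V : Type*} [AddCommGroup V] [Module ℝ V]

theorem form_two_sum_left {ι : Type*} (s : Finset ι) (φ : Form V 2) (c : ι → ℝ) (u : ι → V)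
    (w : V) : φ ![∑ i ∈ s, c i • u i, w] = ∑ i ∈ s, c i * φ ![u i, w] := by
  have h := congrArg (fun f : Form V 1 => f ![w]) (map_sum φ.curryLeft (fun i => c i • u i) s)
  rw [form_sum_apply] at h
  refine h.trans (Finset.sum_congr rfl fun i _ => ?_)
  rw [map_smul]
  rfl

theorem form_two_sum_right {ι : Type*} (s : Finset ι) (φ : Form V 2) (c : ι → ℝ) (u : ι → V)
    (w : V) : φ ![w, ∑ i ∈ s, c i • u i] = ∑ i ∈ s, c i * φ ![w, u i] := by
  rw [form_two_swap, form_two_sum_left, ← Finset.sum_neg_distrib]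
  exact Finset.sum_congr rfl fun i _ => by rw [form_two_swap φ w (u i)]; ring

theorem form_two_sub_left (φ : Form V 2) (u v w : V) :
    φ ![u - v, w] = φ ![u, w] - φ ![v, w] :=
  congrArg (fun f : Form V 1 => f ![w]) (map_sub φ.curryLeft u v)

/-- The `2`-form `(1/2) c_{ij} ϑ^i ∧ ϑ^j`. -/
def twoForm (ϑ : Fin 4 → V →ₗ[ℝ] ℝ) (c : Fin 4 → Fin 4 → ℝ) : Form V 2 :=
  (1 / 2 : ℝ) • ∑ i, ∑ j, c i j • wedge (oneForm (ϑ i)) (oneForm (ϑ j))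

theorem twoForm_apply (ϑ : Fin 4 → V →ₗ[ℝ] ℝ) {c : Fin 4 → Fin 4 → ℝ}
    (hc : ∀ i j, c j i = -c i j) (u v : V) :
    twoForm ϑ c ![u, v] = ∑ i, ∑ j, c i j * (ϑ i u * ϑ j v) := by
  have hw : ∀ i j, wedge (oneForm (ϑ i)) (oneForm (ϑ j)) ![u, v] = ϑ i u * ϑ j v - ϑ i v * ϑ j u :=
    fun i j => wedge_one_one_apply _ _ ![u, v]
  have h1 : twoForm ϑ c ![u, v] =
      1 / 2 * ∑ i, ∑ j, c i j * (ϑ i u * ϑ j v - ϑ i v * ϑ j u) := by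
    simp only [← hw, twoForm, AlternatingMap.smul_apply, form_sum_apply, smul_eq_mul]
  have h2 : ∑ i, ∑ j, c i j * (ϑ i v * ϑ j u) = -∑ i, ∑ j, c i j * (ϑ i u * ϑ j v) := by
    rw [Finset.sum_comm, ← Finset.sum_neg_distrib]
    refine Finset.sum_congr rfl fun i _ => ?_
    rw [← Finset.sum_neg_distrib]
    exact Finset.sum_congr rfl fun j _ => by rw [hc i j]; ring
  rw [h1]
  simp only [mul_sub, Finset.sum_sub_distrib]
  rw [h2]
  ring

theorem twoForm_frame {e : Fin 4 → V} {ϑ : Fin 4 → V →ₗ[ℝ] ℝ}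
    (hd : ∀ α β, ϑ α (e β) = if α = β then 1 else 0) {c : Fin 4 → Fin 4 → ℝ}
    (hc : ∀ i j, c j i = -c i j) (i j : Fin 4) : twoForm ϑ c ![e i, e j] = c i j := by
  rw [twoForm_apply ϑ hc]
  simp [hd]

end Pointwise

section Manifold

variable {M : Type*} [TopologicalSpace M] [ChartedSpace E4 M]

theorem mvfderiv_finset_sum {ι : Type*} (s : Finset ι) {f : ι → M → ℝ} {x : M}
    (hf : ∀ i ∈ s, MDifferentiableAt (𝓡 4) 𝓘(ℝ, ℝ) (f i) x) (v : TangentSpace (𝓡 4) x) :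
    MDifferentiableAt (𝓡 4) 𝓘(ℝ, ℝ) (fun y => ∑ i ∈ s, f i y) x ∧
    mvfderiv (𝓡 4) (fun y => ∑ i ∈ s, f i y) x v = ∑ i ∈ s, mvfderiv (𝓡 4) (f i) x v := by
  classical
  induction s using Finset.induction_on with
  | empty =>
    simp only [Finset.sum_empty]
    exact ⟨mdifferentiableAt_const, by rw [mvfderiv_const]; rfl⟩
  | insert a s ha ih =>
    simp only [Finset.sum_insert ha]
    have h1 := hf a (Finset.mem_insert_self a s)
    obtain ⟨h2, h3⟩ := ih fun i hi => hf i (Finset.mem_insert_of_mem hi)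
    refine ⟨h1.add h2, ?_⟩
    rw [mvfderiv_fun_add h1 h2, ← h3]
    rfl

variable [IsManifold (𝓡 4) ∞ M]

variable {g : LorentzMetric M} {e : Fin 4 → VField M} {U : Set M}

/-- The derivative `Y ↦ v (Y^k) e_k` of a vector field along `v` for which the frame is parallel. -/
def frameCov (g : LorentzMetric M) (e : Fin 4 → VField M) (Y : VField M) (x : M)
    (v : TangentSpace (𝓡 4) x) : TangentSpace (𝓡 4) x :=
  ∑ k, mvfderiv (𝓡 4) (fun y => coframe g e y k (Y y)) x v • e k x

theorem form_two_frame_expansion (he : IsTetradOn g e U) {y : M} (hy : y ∈ U)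
    (φ : Form (TangentSpace (𝓡 4) y) 2) (u v : TangentSpace (𝓡 4) y) :
    φ ![u, v] = ∑ i, ∑ j, coframe g e y i u * (coframe g e y j v * φ ![e i y, e j y]) := by
  conv_lhs => rw [← sum_coframe_smul_frame he hy u, ← sum_coframe_smul_frame he hy v]
  rw [form_two_sum_left]
  refine Finset.sum_congr rfl fun i _ => ?_
  rw [form_two_sum_right, Finset.mul_sum]

/-- The product rule for `φ (Y, Z)`. -/
theorem mvfderiv_form_two (he : IsTetradOn g e U) (hU : IsOpen U) {x : M} (hx : x ∈ U)
    {φ : ∀ x : M, Form (TangentSpace (𝓡 4) x) 2}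
    (hφ : ∀ i j, MDifferentiableAt (𝓡 4) 𝓘(ℝ, ℝ) (fun y => φ y ![e i y, e j y]) x)
    {Y Z : VField M} (hY : DiffAt Y x) (hZ : DiffAt Z x) (v : TangentSpace (𝓡 4) x) :
    mvfderiv (𝓡 4) (fun y => φ y ![Y y, Z y]) x v =
      ∑ i, ∑ j, mvfderiv (𝓡 4) (fun y => φ y ![e i y, e j y]) x v *
          (coframe g e x i (Y x) * coframe g e x j (Z x))
        + φ x ![frameCov g e Y x v, Z x] + φ x ![Y x, frameCov g e Z x v] := by
  have hc := fun {Y : VField M} (hY : DiffAt Y x) k => mdifferentiableAt_coframe he hU hx hY k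
  have h : (fun y => φ y ![Y y, Z y]) =ᶠ[nhds x] fun y => ∑ i, ∑ j,
      coframe g e y i (Y y) * (coframe g e y j (Z y) * φ y ![e i y, e j y]) :=
    Filter.eventually_of_mem (hU.mem_nhds hx) fun y hy =>
      form_two_frame_expansion he hy (φ y) (Y y) (Z y)
  have hp : ∀ i j, MDifferentiableAt (𝓡 4) 𝓘(ℝ, ℝ) (fun y =>
      coframe g e y i (Y y) * (coframe g e y j (Z y) * φ y ![e i y, e j y])) x := fun i j =>
    (hc hY i).mul ((hc hZ j).mul (hφ i j))
  have hD : ∀ i j, mvfderiv (𝓡 4) (fun y =>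
      coframe g e y i (Y y) * (coframe g e y j (Z y) * φ y ![e i y, e j y])) x v =
      mvfderiv (𝓡 4) (fun y => φ y ![e i y, e j y]) x v *
        (coframe g e x i (Y x) * coframe g e x j (Z x))
      + mvfderiv (𝓡 4) (fun y => coframe g e y i (Y y)) x v *
        (coframe g e x j (Z x) * φ x ![e i x, e j x])
      + coframe g e x i (Y x) * (mvfderiv (𝓡 4) (fun y => coframe g e y j (Z y)) x v
        * φ x ![e i x, e j x]) := fun i j => by
    have hq : MDifferentiableAt (𝓡 4) 𝓘(ℝ, ℝ)
      (fun y => coframe g e y j (Z y) * φ y ![e i y, e j y]) x := (hc hZ j).mul (hφ i j)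
    rw [mvfderiv_fun_mul (hc hY i) hq, mvfderiv_fun_mul (hc hZ j) (hφ i j)]
    simp only [add_apply, smul_apply, smul_eq_mul]
    ring
  rw [mvfderiv_congr h, (mvfderiv_finset_sum _ (fun i _ =>
    (mvfderiv_finset_sum _ (fun j _ => hp i j) v).1) v).2]
  have hs := fun i => (mvfderiv_finset_sum Finset.univ (fun j _ => hp i j) v).2
  simp only [hs, hD, Finset.sum_add_distrib]
  congr 1
  · congr 1
    rw [frameCov, form_two_sum_left]
    refine Finset.sum_congr rfl fun i _ => ?_
    conv_rhs => rw [← sum_coframe_smul_frame he hx (Z x)]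
    rw [form_two_sum_right, Finset.mul_sum]
  · conv_rhs => rw [← sum_coframe_smul_frame he hx (Y x)]
    rw [form_two_sum_left]
    refine Finset.sum_congr rfl fun i _ => ?_
    rw [frameCov, form_two_sum_right, Finset.mul_sum]

/-- The torsion of the derivative `frameCov` is tensorial. -/
theorem mlieBracket_eq_frameCov (he : IsTetradOn g e U) (hU : IsOpen U) {x : M} (hx : x ∈ U)
    {Y Z : VField M} (hY : DiffAt Y x) (hZ : DiffAt Z x) :
    VectorField.mlieBracket (𝓡 4) Y Z x = frameCov g e Z x (Y x) - frameCov g e Y x (Z x)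
      - ∑ k, twoForm (coframe g e x) (fun i j => frameTorsion g e k i j x) ![Y x, Z x] • e k x := by
  have hfr := fun l => (he.smooth l).diffAt hU hx
  have hexp : ∀ Y : VField M, Y =ᶠ[nhds x] fun y => ∑ j, coframe g e y j (Y y) • e j y := fun Y =>
    Filter.eventually_of_mem (hU.mem_nhds hx) fun y hy => (sum_coframe_smul_frame he hy (Y y)).symm
  have hbr : ∀ {Y Z : VField M}, DiffAt Z x → VectorField.mlieBracket (𝓡 4) Y Z x =
      ∑ j, (mvfderiv (𝓡 4) (fun y => coframe g e y j (Z y)) x (Y x) • e j x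
        + coframe g e x j (Z x) • VectorField.mlieBracket (𝓡 4) Y (e j) x) := fun {Y Z} hZ => by
    have h1 := Filter.EventuallyEq.mlieBracket_vectorField_eq (I := 𝓡 4)
      (Filter.EventuallyEq.refl (nhds x) Y) (hexp Z)
    exact h1.trans (mlieBracket_sum_smul (f := fun j y => coframe g e y j (Z y)) Finset.univ Y
      (fun j _ => mdifferentiableAt_coframe he hU hx hZ j) (fun j _ => hfr j))
  -- Compare the components along the frame.
  have hco : ∀ u w : TangentSpace (𝓡 4) x,
      (∀ k, coframe g e x k u = coframe g e x k w) → u = w := fun u w h => by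
    rw [← sum_coframe_smul_frame he hx u, ← sum_coframe_smul_frame he hx w]
    simp only [h]
  refine hco _ _ fun k => ?_
  have h2 : ∀ j, coframe g e x k (VectorField.mlieBracket (𝓡 4) Y (e j) x) =
      -(mvfderiv (𝓡 4) (fun y => coframe g e y k (Y y)) x (e j x))
        - ∑ i, coframe g e x i (Y x) * frameTorsion g e k i j x := fun j => by
    rw [VectorField.mlieBracket_swap_apply, hbr hY, map_neg, Finset.sum_add_distrib, map_add,
      coframe_sum_smul he hx
        (fun l => mvfderiv (𝓡 4) (fun y => coframe g e y l (Y y)) x (e j x)), map_sum]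
    have h3 : ∑ i, coframe g e x k (coframe g e x i (Y x) •
        VectorField.mlieBracket (𝓡 4) (e j) (e i) x) =
        ∑ i, coframe g e x i (Y x) * frameTorsion g e k i j x :=
      Finset.sum_congr rfl fun i _ => by
        rw [map_smul, VectorField.mlieBracket_swap_apply, map_neg]; rfl
    rw [h3]
    ring
  have h4 : mvfderiv (𝓡 4) (fun y => coframe g e y k (Y y)) x (Z x) =
      ∑ j, coframe g e x j (Z x) * mvfderiv (𝓡 4) (fun y => coframe g e y k (Y y)) x (e j x) := by
    conv_lhs => rw [← sum_coframe_smul_frame he hx (Z x)]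
    rw [map_sum]
    exact Finset.sum_congr rfl fun j _ => map_smul _ _ _
  have h5 : ∑ j, coframe g e x k (coframe g e x j (Z x) •
      VectorField.mlieBracket (𝓡 4) Y (e j) x) =
      -mvfderiv (𝓡 4) (fun y => coframe g e y k (Y y)) x (Z x)
      - ∑ i, ∑ j, frameTorsion g e k i j x * (coframe g e x i (Y x) * coframe g e x j (Z x)) := by
    rw [h4, Finset.sum_comm, ← Finset.sum_neg_distrib, ← Finset.sum_sub_distrib]
    refine Finset.sum_congr rfl fun j _ => ?_
    rw [map_smul, h2, smul_eq_mul, mul_sub, Finset.mul_sum]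
    congr 1
    · ring
    · exact Finset.sum_congr rfl fun i _ => by ring
  rw [hbr hZ, Finset.sum_add_distrib, map_add, map_sub, map_sub, frameCov, frameCov,
    coframe_sum_smul he hx (fun l => mvfderiv (𝓡 4) (fun y => coframe g e y l (Z y)) x (Y x)),
    coframe_sum_smul he hx (fun l => mvfderiv (𝓡 4) (fun y => coframe g e y l (Y y)) x (Z x)),
    coframe_sum_smul he hx (fun k => twoForm (coframe g e x)
      (fun i j => frameTorsion g e k i j x) ![Y x, Z x]),
    twoForm_apply _ (fun i j => frameTorsion_swap k i j x), map_sum, h5]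
  ring

/-- The exterior derivative `dφ = ϑ^m ∧ ∇_m φ + (e_k ⌋ φ) ∧ T^k` in terms of the derivative for
which the frame is parallel and its torsion. In particular it is a tensor. -/
def frameExtDeriv (g : LorentzMetric M) (e : Fin 4 → VField M)
    (φ : ∀ x : M, Form (TangentSpace (𝓡 4) x) 2) (x : M) : Form (TangentSpace (𝓡 4) x) 3 :=
  (∑ m, wedge (oneForm (coframe g e x m)) (twoForm (coframe g e x) fun i j =>
      mvfderiv (𝓡 4) (fun y => φ y ![e i y, e j y]) x (e m x)))
    + ∑ k, wedge (contract (e k x) (φ x))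
      (twoForm (coframe g e x) fun i j => frameTorsion g e k i j x)

theorem frameExtDeriv_apply (φ : ∀ x : M, Form (TangentSpace (𝓡 4) x) 2) (x : M)
    (v : Fin 3 → TangentSpace (𝓡 4) x) :
    frameExtDeriv g e φ x v =
      ∑ m, (coframe g e x m (v 0) * twoForm (coframe g e x) (fun i j =>
          mvfderiv (𝓡 4) (fun y => φ y ![e i y, e j y]) x (e m x)) ![v 1, v 2]
        - coframe g e x m (v 1) * twoForm (coframe g e x) (fun i j =>
          mvfderiv (𝓡 4) (fun y => φ y ![e i y, e j y]) x (e m x)) ![v 0, v 2]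
        + coframe g e x m (v 2) * twoForm (coframe g e x) (fun i j =>
          mvfderiv (𝓡 4) (fun y => φ y ![e i y, e j y]) x (e m x)) ![v 0, v 1])
      + ∑ k, (φ x ![e k x, v 0] * twoForm (coframe g e x)
          (fun i j => frameTorsion g e k i j x) ![v 1, v 2]
        - φ x ![e k x, v 1] * twoForm (coframe g e x)
          (fun i j => frameTorsion g e k i j x) ![v 0, v 2]
        + φ x ![e k x, v 2] * twoForm (coframe g e x)
          (fun i j => frameTorsion g e k i j x) ![v 0, v 1]) := by
  rw [frameExtDeriv, AlternatingMap.add_apply, form_sum_apply, form_sum_apply]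
  exact congrArg₂ (· + ·) (Finset.sum_congr rfl fun m _ => wedge_one_two_apply _ _ v)
    (Finset.sum_congr rfl fun m _ => wedge_one_two_apply _ _ v)

/-- In the invariant formula for `dφ` the derivatives of the arguments cancel against the brackets,
which leaves only the torsion of `frameCov`. -/
theorem extDeriv2_eq_frameExtDeriv (he : IsTetradOn g e U) (hU : IsOpen U) {x : M} (hx : x ∈ U)
    {φ : ∀ x : M, Form (TangentSpace (𝓡 4) x) 2}
    (hφ : ∀ i j, MDifferentiableAt (𝓡 4) 𝓘(ℝ, ℝ) (fun y => φ y ![e i y, e j y]) x)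
    {X : Fin 3 → VField M} (hX : ∀ i, DiffAt (X i) x) :
    extDeriv2 φ X x = frameExtDeriv g e φ x fun i => X i x := by
  have hsw : ∀ (v : TangentSpace (𝓡 4) x) (i j : Fin 4),
      mvfderiv (𝓡 4) (fun y => φ y ![e j y, e i y]) x v =
        -mvfderiv (𝓡 4) (fun y => φ y ![e i y, e j y]) x v := fun v i j => by
    have h : (fun y => φ y ![e j y, e i y]) = fun y => -φ y ![e i y, e j y] :=
      funext fun y => form_two_swap _ _ _
    rw [h, mvfderiv_fun_neg]
    rfl
  have hd : ∀ u v w : TangentSpace (𝓡 4) x,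
      ∑ m, coframe g e x m u * twoForm (coframe g e x) (fun i j =>
        mvfderiv (𝓡 4) (fun y => φ y ![e i y, e j y]) x (e m x)) ![v, w] =
      ∑ i, ∑ j, mvfderiv (𝓡 4) (fun y => φ y ![e i y, e j y]) x u *
          (coframe g e x i v * coframe g e x j w) := fun u v w => by
    have h1 : ∀ i j, mvfderiv (𝓡 4) (fun y => φ y ![e i y, e j y]) x u =
        ∑ m, coframe g e x m u * mvfderiv (𝓡 4) (fun y => φ y ![e i y, e j y]) x (e m x) :=
      fun i j => by
        conv_lhs => rw [← sum_coframe_smul_frame he hx u]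
        rw [map_sum]
        exact Finset.sum_congr rfl fun m _ => map_smul _ _ _
    simp only [twoForm_apply _ (hsw _), h1, Finset.sum_mul, Finset.mul_sum]
    rw [Finset.sum_comm]
    refine Finset.sum_congr rfl fun i _ => ?_
    rw [Finset.sum_comm]
    exact Finset.sum_congr rfl fun j _ => Finset.sum_congr rfl fun m _ => by ring
  have ht : ∀ u v w : TangentSpace (𝓡 4) x,
      φ x ![∑ k, twoForm (coframe g e x) (fun i j => frameTorsion g e k i j x) ![u, v] • e k x, w] =
        ∑ k, φ x ![e k x, w] * twoForm (coframe g e x)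
          (fun i j => frameTorsion g e k i j x) ![u, v] := fun u v w => by
    rw [form_two_sum_left]
    exact Finset.sum_congr rfl fun k _ => mul_comm _ _
  rw [frameExtDeriv_apply]
  simp only [Finset.sum_add_distrib, Finset.sum_sub_distrib, hd]
  rw [extDeriv2, mvfderiv_form_two he hU hx hφ (hX 1) (hX 2),
    mvfderiv_form_two he hU hx hφ (hX 0) (hX 2), mvfderiv_form_two he hU hx hφ (hX 0) (hX 1),
    mlieBracket_eq_frameCov he hU hx (hX 0) (hX 1), mlieBracket_eq_frameCov he hU hx (hX 0) (hX 2),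
    mlieBracket_eq_frameCov he hU hx (hX 1) (hX 2)]
  simp only [form_two_sub_left, ht]
  rw [form_two_swap (φ x) (frameCov g e (X 1) x (X 2 x)) (X 0 x),
    form_two_swap (φ x) (frameCov g e (X 2) x (X 1 x)) (X 0 x),
    form_two_swap (φ x) (frameCov g e (X 2) x (X 0 x)) (X 1 x)]
  ring

end Manifold

section Manifold

variable {M : Type*} [TopologicalSpace M] [ChartedSpace E4 M] [IsManifold (𝓡 4) ∞ M]

variable {g : LorentzMetric M} {e : Fin 4 → VField M} {U : Set M} {nablaW nablaLC : Conn M}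

/-! ### The field equation of the Weitzenböck connection -/

theorem IsWeitzenbockOn.cov_frame_eq_zero (hW : IsWeitzenbockOn nablaW e U)
    (he : IsTetradOn g e U) {x : M} (hx : x ∈ U) (β : Fin 4) : nablaW (e β) x = 0 := by
  ext1 v
  rw [← sum_coframe_smul_frame he hx v, map_sum]
  exact Finset.sum_eq_zero fun α _ => by rw [map_smul, hW.parallel x hx, smul_zero]

theorem IsWeitzenbockOn.connectionForm_eq_zero (hW : IsWeitzenbockOn nablaW e U)
    (he : IsTetradOn g e U) {x : M} (hx : x ∈ U) (α β : Fin 4) :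
    connectionForm g e nablaW x α β = 0 := by
  ext v
  change coframe g e x β (nablaW (e α) x (v 0)) = 0
  rw [hW.cov_frame_eq_zero he hx]
  exact map_zero _

theorem IsWeitzenbockOn.torsionForm_eq (hW : IsWeitzenbockOn nablaW e U) {x : M} (hx : x ∈ U)
    (α : Fin 4) : torsionForm g e nablaW x α =
      twoForm (coframe g e x) fun i j => frameTorsion g e α i j x := by
  have h : ∀ i j, coframe g e x α (torsion nablaW (e i) (e j) x) = frameTorsion g e α i j x :=
    fun i j => by
      simp only [torsion, hW.parallel x hx, sub_zero, zero_sub, map_neg, frameTorsion]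
  simp only [torsionForm, h, twoForm]

theorem IsWeitzenbockOn.torsionForm_frame (hW : IsWeitzenbockOn nablaW e U)
    (he : IsTetradOn g e U) {x : M} (hx : x ∈ U) (α i j : Fin 4) :
    torsionForm g e nablaW x α ![e i x, e j x] = frameTorsion g e α i j x := by
  rw [hW.torsionForm_eq hx]
  exact twoForm_frame (coframe_apply_frame he hx) (fun i j => frameTorsion_swap α i j x) i j

theorem IsWeitzenbockOn.frameComponents_torsionForm (hW : IsWeitzenbockOn nablaW e U)
    (he : IsTetradOn g e U) {x : M} (hx : x ∈ U) :
    frameComponents (fun α => e α x) (torsionForm g e nablaW x) =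
      (frameTorsion g e · · · x) := by
  ext α i j
  exact hW.torsionForm_frame he hx α i j

theorem IsWeitzenbockOn.excitationForm_frame (hW : IsWeitzenbockOn nablaW e U)
    (he : IsTetradOn g e U) (κ : ℝ) {x : M} (hx : x ∈ U) (α i j : Fin 4) :
    excitationForm κ g e nablaW x α ![e i x, e j x] =
      1 / κ * dualSuperpotential (frameTorsion g e · · · x) α i j := by
  rw [← hW.frameComponents_torsionForm he hx]
  exact excitation_frame (coframe_apply_frame he hx) κ _ α i j

/-- The components of the excitation are linear in those of the torsion, so the same formula
gives their derivatives. -/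
theorem IsWeitzenbockOn.mvfderiv_excitationForm_frame (hW : IsWeitzenbockOn nablaW e U)
    (he : IsTetradOn g e U) (hU : IsOpen U) (κ : ℝ) {x : M} (hx : x ∈ U) (α i j m : Fin 4) :
    MDifferentiableAt (𝓡 4) 𝓘(ℝ, ℝ)
      (fun y => excitationForm κ g e nablaW y α ![e i y, e j y]) x ∧
    mvfderiv (𝓡 4) (fun y => excitationForm κ g e nablaW y α ![e i y, e j y]) x (e m x) =
      1 / κ * dualSuperpotential (frameDeriv e (frameTorsion g e) x m) α i j := by
  have h0 : dualSuperpotential (0 : Fin 4 → Fin 4 → Fin 4 → ℝ) = 0 := by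
    have h := dualSuperpotential_add_smul 0 0 1
    simpa using h
  have hadd : ∀ t u, dualSuperpotential (t + u) = dualSuperpotential t + dualSuperpotential u :=
    fun t u => by simpa using dualSuperpotential_add_smul t u 1
  have hsmul : ∀ (s : ℝ) t, dualSuperpotential (s • t) = s • dualSuperpotential t :=
    fun s t => by simpa [h0] using dualSuperpotential_add_smul 0 t s
  let L : (Fin 4 → Fin 4 → Fin 4 → ℝ) →ₗ[ℝ] ℝ :=
    { toFun := fun t => 1 / κ * dualSuperpotential t α i j
      map_add' := fun t u => by rw [hadd]; exact mul_add _ _ _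
      map_smul' := fun s t => by rw [hsmul]; exact mul_left_comm _ _ _ }
  have h : (fun y => excitationForm κ g e nablaW y α ![e i y, e j y]) =ᶠ[nhds x] fun y =>
      L fun k i j => frameTorsion g e k i j y :=
    Filter.eventually_of_mem (hU.mem_nhds hx) fun y hy => hW.excitationForm_frame he κ hy α i j
  obtain ⟨h1, h2⟩ := mvfderiv_linear_components L (mdifferentiableAt_frameTorsion he hU hx) (e m x)
  exact ⟨h1.congr_of_eventuallyEq h, by rw [mvfderiv_congr h, h2]; rfl⟩

/-- The left-hand side `D H_α - e_α ⌋ L - (e_α ⌋ T^β) ∧ H_β` of the field equation as a `3`-form;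
`D` is the exterior derivative because the frame is parallel. -/
def fieldForm (κ : ℝ) (g : LorentzMetric M) (e : Fin 4 → VField M) (cov : Conn M)
    (α : Fin 4) (x : M) : Form (TangentSpace (𝓡 4) x) 3 :=
  frameExtDeriv g e (fun y => excitationForm κ g e cov y α) x
    - contract (e α x) (lagrangianForm κ g e cov x)
    - ∑ β, wedge (contract (e α x) (torsionForm g e cov x β)) (excitationForm κ g e cov x β)

theorem IsWeitzenbockOn.fieldOperator_eq (hW : IsWeitzenbockOn nablaW e U)
    (he : IsTetradOn g e U) (hU : IsOpen U) (κ : ℝ) {x : M} (hx : x ∈ U) (α : Fin 4)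
    {X : Fin 3 → VField M} (hX : ∀ i, DiffAt (X i) x) :
    fieldOperator κ g e nablaW α X x = fieldForm κ g e nablaW α x fun i => X i x := by
  have h0 : ∀ β, wedge (connectionForm g e nablaW x α β) (excitationForm κ g e nablaW x β)
      (fun i => X i x) = 0 := fun β => by
    refine (wedge_one_two_apply _ _ _).trans ?_
    rw [hW.connectionForm_eq_zero he hx]
    simp
  have h1 := extDeriv2_eq_frameExtDeriv he hU hx
    (φ := fun y => excitationForm κ g e nablaW y α)
    (fun i j => (hW.mvfderiv_excitationForm_frame he hU κ hx α i j 0).1) hX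
  rw [fieldOperator, covExtDeriv2, Finset.sum_eq_zero fun β _ => h0 β, sub_zero, h1, fieldForm,
    AlternatingMap.sub_apply, AlternatingMap.sub_apply, form_sum_apply]

theorem eta1Up_frame {x : M} (he : IsTetradOn g e U) (hx : x ∈ U) (β i j k : Fin 4) :
    eta1Up (fun γ => e γ x) (coframe g e x) β ![e i x, e j x, e k x] =
      sgn β * leviCivita β i j k :=
  congrArg (sgn β * ·) (volumeForm_frame (coframe_apply_frame he hx) β i j k)

theorem IsWeitzenbockOn.fieldForm_frame (hW : IsWeitzenbockOn nablaW e U)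
    (he : IsTetradOn g e U) (hU : IsOpen U) (κ : ℝ) {x : M} (hx : x ∈ U) (α i j k : Fin 4) :
    fieldForm κ g e nablaW α x ![e i x, e j x, e k x] = 1 / κ *
      fieldComponents (frameTorsion g e · · · x) (frameDeriv e (frameTorsion g e) x) α i j k := by
  have hd := coframe_apply_frame he hx
  have hH := fun α i j => hW.excitationForm_frame he κ hx α i j
  have hDH := fun m i j => (hW.mvfderiv_excitationForm_frame he hU κ hx α i j m).2
  have hT := fun α i j => hW.torsionForm_frame he hx α i j
  have hds : ∀ t i j, dualSuperpotential t α j i = -dualSuperpotential t α i j :=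
    fun t i j => dualComponents_swap _ i j
  have h1 : frameExtDeriv g e (fun y => excitationForm κ g e nablaW y α) x
      ![e i x, e j x, e k x] = 1 / κ *
      ((dualSuperpotential (frameDeriv e (frameTorsion g e) x i) α j k
        - dualSuperpotential (frameDeriv e (frameTorsion g e) x j) α i k
        + dualSuperpotential (frameDeriv e (frameTorsion g e) x k) α i j)
      + ∑ m, (dualSuperpotential (frameTorsion g e · · · x) α m i * frameTorsion g e m j k x
        - dualSuperpotential (frameTorsion g e · · · x) α m j * frameTorsion g e m i k x
        + dualSuperpotential (frameTorsion g e · · · x) α m k * frameTorsion g e m i j x)) := by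
    have hf : ∀ l a b, twoForm (coframe g e x) (fun i j => frameTorsion g e l i j x)
        ![e a x, e b x] = frameTorsion g e l a b x := fun l a b =>
      twoForm_frame (e := fun γ => e γ x) hd (fun i j => frameTorsion_swap l i j x) a b
    have hf' : ∀ m a b, twoForm (coframe g e x) (fun i j =>
        1 / κ * dualSuperpotential (frameDeriv e (frameTorsion g e) x m) α i j)
        ![e a x, e b x] = 1 / κ * dualSuperpotential (frameDeriv e (frameTorsion g e) x m) α a b :=
      fun m a b => twoForm_frame (e := fun γ => e γ x) hd
        (c := fun i j => 1 / κ * dualSuperpotential (frameDeriv e (frameTorsion g e) x m) α i j)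
        (fun i j => by rw [hds]; ring) a b
    rw [frameExtDeriv_apply]
    simp only [Matrix.cons_val_zero, Matrix.cons_val_one, Matrix.cons_val, hd, hDH, hH, hf, hf',
      Finset.sum_add_distrib, Finset.sum_sub_distrib, ite_mul, one_mul, zero_mul,
      Finset.sum_ite_eq', Finset.mem_univ, if_true, mul_add, mul_sub, Finset.mul_sum, mul_assoc]
  have h2 : contract (e α x) (lagrangianForm κ g e nablaW x) ![e i x, e j x, e k x] =
      -(1 / (2 * κ)) * wedgePairing (frameTorsion g e · · · x)
        (dualSuperpotential (frameTorsion g e · · · x)) * leviCivita α i j k := by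
    obtain ⟨b, hb⟩ := exists_frame_basis he hx
    have hb' : ∀ β, b β = e β x := fun β => congrFun hb β
    have hv := volumeForm_frame (e := fun γ => e γ x) hd α i j k
    have hl := lagrangian_frame (e := fun γ => e γ x) hd κ (torsionForm g e nablaW x)
    rw [hW.frameComponents_torsionForm he hx] at hl
    have hf := form_four_eq_smul_volumeForm b (ϑ := coframe g e x)
      (by simpa only [hb'] using hd) (lagrangianForm κ g e nablaW x)
    simp only [hb'] at hf
    change lagrangianForm κ g e nablaW x ![e α x, e i x, e j x, e k x] = _
    rw [hf, AlternatingMap.smul_apply, hv, smul_eq_mul]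
    exact congrArg (· * (leviCivita α i j k : ℝ)) hl
  have h3 : ∀ β, wedge (contract (e α x) (torsionForm g e nablaW x β))
      (excitationForm κ g e nablaW x β) ![e i x, e j x, e k x] = 1 / κ *
      (frameTorsion g e β α i x * dualSuperpotential (frameTorsion g e · · · x) β j k
        - frameTorsion g e β α j x * dualSuperpotential (frameTorsion g e · · · x) β i k
        + frameTorsion g e β α k x * dualSuperpotential (frameTorsion g e · · · x) β i j) :=
    fun β => by
      refine (wedge_one_two_apply _ _ _).trans ?_
      change torsionForm g e nablaW x β ![e α x, e i x]
          * excitationForm κ g e nablaW x β ![e j x, e k x]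
        - torsionForm g e nablaW x β ![e α x, e j x]
          * excitationForm κ g e nablaW x β ![e i x, e k x]
        + torsionForm g e nablaW x β ![e α x, e k x]
          * excitationForm κ g e nablaW x β ![e i x, e j x] = _
      rw [hH, hH, hH, hT, hT, hT]
      ring
  rw [fieldForm, AlternatingMap.sub_apply, AlternatingMap.sub_apply, form_sum_apply, h1, h2]
  rw [Finset.sum_congr rfl fun β _ => h3 β, ← Finset.mul_sum, fieldComponents, one_div_mul_eq_div]
  field_simp
  ring

theorem fieldForm_eq_einstein (hU : IsOpen U) (he : IsTetradOn g e U)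
    (hW : IsWeitzenbockOn nablaW e U) (hLC : IsLeviCivitaOn g nablaLC U) (κ : ℝ) {x : M}
    (hx : x ∈ U) (α : Fin 4) :
    fieldForm κ g e nablaW α x = ∑ β, (-(1 / κ) * einstein g e nablaLC α β x) •
      eta1Up (fun γ => e γ x) (coframe g e x) β := by
  obtain ⟨b, hb⟩ := exists_frame_basis he hx
  refine form_three_ext b fun i j k hij hjk => ?_
  have hb' : ∀ β, b β = e β x := fun β => congrFun hb β
  rw [hb', hb', hb', hW.fieldForm_frame he hU κ hx, form_sum_apply]
  have ht : (frameTorsion g e · · · x) =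
      torsionOf (connectionCoefficient g e nablaLC · · · x) := by
    ext k i j; exact frameTorsion_eq_torsionOf he hU hLC hx k i j
  have hDt : frameDeriv e (frameTorsion g e) x = fun m =>
      torsionOf (frameDeriv e (connectionCoefficient g e nablaLC) x m) :=
    funext (frameDeriv_frameTorsion he hU hLC hx)
  rw [ht, hDt, fieldComponents_torsionOf _ _ (connectionCoefficient_antisymm he hU hLC hx)
    (frameDeriv_connectionCoefficient_antisymm he hU hLC hx) α hij hjk, mul_neg, Finset.mul_sum,
    ← Finset.sum_neg_distrib]
  refine Finset.sum_congr rfl fun β _ => ?_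
  rw [AlternatingMap.smul_apply, eta1Up_frame he hx, einstein_eq_einsteinOf he hU hLC hx,
    smul_eq_mul]
  ring

/-- The `3`-forms `η^β` are linearly independent: each is the only one that does not vanish on the
three other frame vectors. -/
theorem eta1Up_coefficients_ext (he : IsTetradOn g e U) {x : M} (hx : x ∈ U) {a b : Fin 4 → ℝ}
    (h : ∀ i j k, ∑ β, a β * eta1Up (fun γ => e γ x) (coframe g e x) β ![e i x, e j x, e k x] =
      ∑ β, b β * eta1Up (fun γ => e γ x) (coframe g e x) β ![e i x, e j x, e k x]) : a = b := by
  simp only [eta1Up_frame he hx] at h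
  have h0 : a 0 = b 0 := by simpa [leviCivita_one_two_three] using h 1 2 3
  have h1 : a 1 = b 1 := by simpa [leviCivita_zero_two_three] using h 0 2 3
  have h2 : a 2 = b 2 := by simpa [leviCivita_zero_one_three] using h 0 1 3
  have h3 : a 3 = b 3 := by simpa [leviCivita_zero_one_two] using h 0 1 2
  ext β
  fin_cases β <;> assumption

theorem fieldOperator_eq_einstein (hU : IsOpen U) (he : IsTetradOn g e U)
    (hW : IsWeitzenbockOn nablaW e U) (hLC : IsLeviCivitaOn g nablaLC U) (κ : ℝ) {x : M}
    (hx : x ∈ U) (α : Fin 4) {X : Fin 3 → VField M} (hX : ∀ i, SmoothOn (X i) U) :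
    fieldOperator κ g e nablaW α X x = -(1 / κ) * ∑ β, einstein g e nablaLC α β x *
      eta1Up (fun γ => e γ x) (coframe g e x) β (fun i => X i x) := by
  rw [hW.fieldOperator_eq he hU κ hx α fun i => (hX i).diffAt hU hx,
    fieldForm_eq_einstein hU he hW hLC κ hx, form_sum_apply, Finset.mul_sum]
  exact Finset.sum_congr rfl fun β _ => mul_assoc _ _ _

theorem translationalFieldEquation_iff (hU : IsOpen U) (he : IsTetradOn g e U)
    (hW : IsWeitzenbockOn nablaW e U) (hLC : IsLeviCivitaOn g nablaLC U) {κ : ℝ} (hκ : κ ≠ 0)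
    {𝒯 : Fin 4 → ∀ x : M, Form (TangentSpace (𝓡 4) x) 3} {t : Fin 4 → Fin 4 → M → ℝ}
    (h𝒯 : ∀ x ∈ U, ∀ α, 𝒯 α x =
      ∑ β, t α β x • eta1Up (fun γ => e γ x) (coframe g e x) β) :
    TranslationalFieldEquation κ g e nablaW U 𝒯 ↔
      EinsteinEquation (-κ) g e nablaLC U t := by
  have hsum : ∀ x ∈ U, ∀ α (v : Fin 3 → TangentSpace (𝓡 4) x), 𝒯 α x v =
      ∑ β, t α β x * eta1Up (fun γ => e γ x) (coframe g e x) β v := fun x hx α v => by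
    rw [h𝒯 x hx α, form_sum_apply]
    rfl
  constructor
  · intro h x hx α β
    have hab : (fun β => -(1 / κ) * einstein g e nablaLC α β x) = fun β => t α β x := by
      refine eta1Up_coefficients_ext he hx fun i j k => ?_
      have hX : ∀ l, SmoothOn ((![e i, e j, e k] : Fin 3 → VField M) l) U := fun l => by
        fin_cases l <;> exact he.smooth _
      have hv : (fun l => (![e i, e j, e k] : Fin 3 → VField M) l x) =
          ![e i x, e j x, e k x] := by
        ext1 l; fin_cases l <;> rfl
      have h1 := h α ![e i, e j, e k] hX x hx
      rw [fieldOperator_eq_einstein hU he hW hLC κ hx α hX, hv, hsum x hx, Finset.mul_sum] at h1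
      simpa only [mul_assoc] using h1
    have h2 := congrFun hab β
    rw [← show _ = t α β x from h2]
    field_simp
  · intro h α X hX x hx
    rw [fieldOperator_eq_einstein hU he hW hLC κ hx α hX, hsum x hx, Finset.mul_sum]
    refine Finset.sum_congr rfl fun β _ => ?_
    rw [h x hx α β]
    field_simp

end Manifold

end TEGR
end

theorem mainTheorem1 {M : Type*} [TopologicalSpace M] [ChartedSpace TEGR.E4 M]
    [IsManifold (𝓡 4) ∞ M] (g : TEGR.LorentzMetric M) (U : Set M) (hU : IsOpen U)
    (e : Fin 4 → TEGR.VField M) (he : TEGR.IsTetradOn g e U)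
    (nablaW : TEGR.Conn M) (hW : TEGR.IsWeitzenbockOn nablaW e U)
    (nablaLC : TEGR.Conn M) (hLC : TEGR.IsLeviCivitaOn g nablaLC U)
    (κ : ℝ) (hκ : κ ≠ 0) :
    -- `H_α` is the field momentum `-∂L/∂T^α` of the Lagrangian
    (∀ x ∈ U, ∀ (τ : Fin 4 → TEGR.Form (TangentSpace (𝓡 4) x) 2)
      (v : Fin 4 → TangentSpace (𝓡 4) x),
      HasDerivAt
        (fun s : ℝ => TEGR.lagrangian κ (fun α => e α x) (TEGR.coframe g e x)
          (fun α => TEGR.torsionForm g e nablaW x α + s • τ α) v)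
        (-∑ α, TEGR.wedge (τ α) (TEGR.excitationForm κ g e nablaW x α) v) 0) ∧
    -- `D H_α - e_α ⌋ L - (e_α ⌋ T^β) ∧ H_β = -(1/κ) (R_{αβ} - (1/2) R g_{αβ}) η^β`
    (∀ (α : Fin 4) (X : Fin 3 → TEGR.VField M), (∀ i, TEGR.SmoothOn (X i) U) → ∀ x ∈ U,
      TEGR.fieldOperator κ g e nablaW α X x =
        -(1 / κ) * ∑ β, TEGR.einstein g e nablaLC α β x *
          TEGR.eta1Up (fun γ => e γ x) (TEGR.coframe g e x) β (fun i => X i x)) ∧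
    -- equivalence with Einstein's equation, for the matter current `𝒯_α = t_{αβ} η^β`
    (∀ (𝒯 : Fin 4 → ∀ x : M, TEGR.Form (TangentSpace (𝓡 4) x) 3)
      (t : Fin 4 → Fin 4 → M → ℝ),
      (∀ x ∈ U, ∀ α, 𝒯 α x =
        ∑ β, t α β x • TEGR.eta1Up (fun γ => e γ x) (TEGR.coframe g e x) β) →
      (TEGR.TranslationalFieldEquation κ g e nablaW U 𝒯 ↔
        TEGR.EinsteinEquation (-κ) g e nablaLC U t) ∧
      (TEGR.TranslationalFieldEquation (-κ) g e nablaW U 𝒯 ↔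
        TEGR.EinsteinEquation κ g e nablaLC U t)) := by
  refine ⟨fun x hx τ v => ?_, fun α X hX x hx =>
    TEGR.fieldOperator_eq_einstein hU he hW hLC κ hx α hX, fun 𝒯 t h𝒯 =>
    ⟨TEGR.translationalFieldEquation_iff hU he hW hLC hκ h𝒯, ?_⟩⟩
  · obtain ⟨b, hb⟩ := TEGR.exists_frame_basis he hx
    have hd := TEGR.coframe_apply_frame he hx
    have h := TEGR.hasDerivAt_lagrangian b (ϑ := TEGR.coframe g e x)
      (fun α β => by rw [hb]; exact hd α β) (κ := κ) (TEGR.torsionForm g e nablaW x) τ v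
    rw [hb] at h
    exact h
  · simpa only [neg_neg] using
      TEGR.translationalFieldEquation_iff hU he hW hLC (neg_ne_zero.2 hκ) h𝒯
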